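/- Let $\Bbbk$ be an algebraically closed field of characteristic $0$, $(a_{ij})$ an $m\times m$ Cartan matrix of finite type, $d_i\in\{1,2,3\}$ with $c_{ij}:=d_ia_{ij}$ symmetric, $n\ge 4$, $q\in\Bbbk$ a primitive $n^2$-th root of unity and $\mathfrak q=q^n$. Put $[N]_d^!=\prod_{h=1}^N\frac{q^{dh}-q^{-dh}}{q^d-q^{-d}}$ and $\left[{N\atop s}\right]_d=\frac{[N]_d^!}{[N-s]_d^!\,[s]_d^!}$. Let $H$ be a finite dimensional Hopf algebra generated by grouplike elements $g_i$, generating a group isomorphic to $(\mathbb Z_{n^2})^m$, and elements $e_i$ $(1\le i\le m)$ such that $g_i^{n^2}=1$, $g_ig_j=g_jg_i$, $g_ie_jg_i^{-1}=q^{\delta_{ij}}e_j$, $e_i^{l_i}=0$ with $l_i=\mathrm{ord}(q^{c_{ii}})$, $\sum_{r+s=1-a_{ij}}(-1)^s\left[{1-a_{ij}\atop s}\right]_{d_i}e_i^re_je_i^s=0$ for $i\ne j$, and $\Delta(e_i)=e_i\otimes K_i+1\otimes e_i$ with $K_i=\prod_jg_j^{c_{ij}}$; assume that $H$ is graded with $\deg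 g_i=0$, $\deg e_i=1$. For $a\in(\mathbb Z_{n^2})^m$ let $1_a=\prod_i\frac1{n^2}\sum_{t=0}^{n^2-1}q^{(n^2-a_i)t}g_i^t$, and let $$J=\sum_{a,b\in(\mathbb Z_{n^2})^m}\ \prod_{i,j=1}^m q^{-c_{ij}a_i(b_j-b_j')}\,1_a\otimes1_b ,$$ where entries are represented in $\{0,\dots,n^2-1\}$ and $y'$ is the remainder of $y$ modulo $n$. Let $A_q(\mathfrak g)\subset H$ be the subalgebra generated by the $h_i=g_i^n$ and the $e_i$, with comultiplication the restriction of $\Delta_J(x)=J\Delta(x)J^{-1}$, and let $M_q(\mathfrak g)=A_q(\mathfrak g)^*$ with the dual (in general non-associative) product $(\varphi\cdot\psi)(x)=(\varphi\otimes\psi)(\Delta_J(x))$ and unit $\varepsilon$. For $a\in(\mathbb Z_n)^m$ let $\mathbf 1_a=\prod_i\frac1n\sum_{t=0}^{n-1}\mathfrak q^{(n-a_i)t}h_i^t$. Choose a basis of $A_q(\mathfrak g)$ consisting of homogeneous elements and containing all $\mathbf 1_ae_i$, and let $\Gamma^i=(\mathbf 1_{\epsilon_i}e_i)^*\in M_q(\mathfrak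 g)$ be the corresponding element of the dual basis, where $\epsilon_i$ is the $i$-th unit vector. Write $X^{\vec r}=(\cdots((X\cdot X)\cdot X)\cdots)\cdot X$ ($r$ factors, $X^{\vec 0}=\varepsilon$). Then for all $1\le i\ne j\le m$, except when $n=4$ and $a_{ij}=-3$ (which occurs only for components of type $G_2$), one has $$\sum_{r+s=1-a_{ij}}(-1)^s\left[{1-a_{ij}\atop s}\right]_{d_i}\bigl((\Gamma^i)^{\vec r}\cdot\Gamma^j\bigr)\cdot(\Gamma^i)^{\vec s}=0 .$$ -/

import Mathlib

open scoped TensorProduct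

/-! ### Cartan data and Gaussian binomials -/

/-- A Cartan matrix of finite type together with a vector `d` with entries in `{1, 2, 3}` that
symmetrizes it.  A generalized Cartan matrix is of finite type when its symmetrization is
positive definite. -/
structure CartanDatum (m : ℕ) where
  a : Matrix (Fin m) (Fin m) ℤ
  d : Fin m → ℕ
  diag : ∀ i, a i i = 2
  nonpos : ∀ i j, i ≠ j → a i j ≤ 0
  zero_symm : ∀ i j, a i j = 0 → a j i = 0
  d_mem : ∀ i, d i = 1 ∨ d i = 2 ∨ d i = 3
  symm : ∀ i j, (d i : ℤ) * a i j = (d j : ℤ) * a j i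
  posDef : (Matrix.of fun i j => ((d i : ℝ) * (a i j : ℝ))).PosDef

/-- The entries `c i j = d i * a i j` of the symmetrized Cartan matrix. -/
def CartanDatum.c {m : ℕ} (C : CartanDatum m) (i j : Fin m) : ℤ := (C.d i : ℤ) * C.a i j

/-- `[N]_d^! = ∏_{h=1}^N (q^{dh} - q^{-dh}) / (q^d - q^{-d})`. -/
noncomputable def qFactorial {k : Type*} [Field k] (q : k) (d N : ℕ) : k :=
  ∏ h ∈ Finset.Icc 1 N, (q ^ (d * h) - (q ^ (d * h))⁻¹) / (q ^ d - (q ^ d)⁻¹)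

/-- The Gaussian binomial coefficient `[N choose s]_d = [N]_d^! / ([N-s]_d^! [s]_d^!)`,
for `s ≤ N`. -/
noncomputable def qBinomial {k : Type*} [Field k] (q : k) (d N s : ℕ) : k :=
  qFactorial q d N / (qFactorial q d (N - s) * qFactorial q d s)

/-! ### The Hopf algebra `H` -/

/-- The (ordered) product `∏ i, g i ^ b i`, used for pairwise commuting units. -/
def unitMonomial {H : Type*} [Monoid H] {m : ℕ} (g : Fin m → Hˣ) (b : Fin m → ℤ) : Hˣ :=
  (List.ofFn fun i => g i ^ b i).prod

/-- The span of the elements `(∏ i, g i ^ b i) * e_{w 1} * ⋯ * e_{w N}`, i.e. the elements of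
degree `N` when the `g i` have degree `0` and the `e i` have degree `1`. -/
def degreeSpan (k : Type*) [Field k] {H : Type*} [Ring H] [Algebra k H] {m : ℕ}
    (g : Fin m → Hˣ) (e : Fin m → H) (N : ℕ) : Submodule k H :=
  Submodule.span k {x | ∃ (b : Fin m → ℤ) (w : List (Fin m)),
    w.length = N ∧ x = (unitMonomial g b : H) * (w.map e).prod}

/-- `QuantumBorel k n q C H`: the Hopf algebra `H` is generated by grouplike elements `g i`
that generate a copy of `(ℤ/n²)^m` and by skew-primitive elements `e i`, subject to the relations
of the (upper triangular) small quantum group with Cartan datum `C` at the primitive `n²`-th root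
of unity `q`, and `H` is graded by the degree in the `e i`. -/
structure QuantumBorel (k : Type*) [Field k] (n : ℕ) (q : k) {m : ℕ} (C : CartanDatum m)
    (H : Type*) [Ring H] [HopfAlgebra k H] where
  two_le : 2 ≤ n
  prim : IsPrimitiveRoot q (n ^ 2)
  g : Fin m → Hˣ
  e : Fin m → H
  generated : Algebra.adjoin k (Set.range (fun i => (g i : H)) ∪ Set.range e) = ⊤
  g_groupLike : ∀ i, IsGroupLikeElem k (g i : H)
  g_pow : ∀ i, g i ^ (n ^ 2) = 1
  g_comm : ∀ i j, g i * g j = g j * g i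
  /-- the `g i` generate a group isomorphic to `(ℤ/n²)^m` -/
  g_free : ∀ b : Fin m → ℤ, unitMonomial g b = 1 → ∀ i, ((n ^ 2 : ℕ) : ℤ) ∣ b i
  g_e : ∀ i j, (g i : H) * e j * ((g i)⁻¹ : Hˣ) = q ^ (if i = j then 1 else 0 : ℕ) • e j
  e_pow : ∀ i, e i ^ orderOf (q ^ C.c i i) = 0
  serre : ∀ i j, i ≠ j → ∑ p ∈ Finset.HasAntidiagonal.antidiagonal (1 - C.a i j).toNat,
    ((-1) ^ p.2 * qBinomial q (C.d i) (1 - C.a i j).toNat p.2) • (e i ^ p.1 * e j * e i ^ p.2) = 0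
  /-- `Δ(e i) = e i ⊗ K i + 1 ⊗ e i` with `K i = ∏ j, g j ^ c i j` -/
  comul_e : ∀ i, Coalgebra.comul (R := k) (e i) =
    e i ⊗ₜ[k] ((unitMonomial g (C.c i) : Hˣ) : H) + 1 ⊗ₜ[k] e i
  /-- the relations of `H` are homogeneous -/
  graded : iSupIndep (degreeSpan k g e)

/-! ### Idempotents -/

/-- `(1/N) ∑_{j<N} (ζ^{N-t})^j u^j`: for `u ^ N = 1` and `ζ` a primitive `N`-th root of unity, the
idempotent on which `u` acts as `ζ ^ t`. -/
noncomputable def cyclicIdem {k : Type*} [Field k] {H : Type*} [Ring H] [Algebra k H]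
    (N : ℕ) (ζ : k) (u : H) (t : ℕ) : H :=
  (N : k)⁻¹ • ∑ j ∈ Finset.range N, ((ζ ^ (N - t)) ^ j) • u ^ j

section IdemLemmas

variable {k : Type*} [Field k] {H : Type*} [Ring H] [Algebra k H]

theorem cyclicIdem_eigen {N : ℕ} {ζ : k} {u : H} (hζ : ζ ^ N = 1) (hu : u ^ N = 1) {t : ℕ}
    (ht : t ≤ N) : u * cyclicIdem N ζ u t = ζ ^ t • cyclicIdem N ζ u t := by
  have key : ∑ j ∈ Finset.range N, ((ζ ^ (N - t)) ^ (j + 1)) • u ^ (j + 1)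
      = ∑ j ∈ Finset.range N, ((ζ ^ (N - t)) ^ j) • u ^ j := by
    have h1 := Finset.sum_range_succ (fun j : ℕ => ((ζ ^ (N - t)) ^ j) • u ^ j) N
    have h2 := Finset.sum_range_succ' (fun j : ℕ => ((ζ ^ (N - t)) ^ j) • u ^ j) N
    rw [h1] at h2
    have h3 : ((ζ ^ (N - t)) ^ N) • u ^ N = ((ζ ^ (N - t)) ^ 0) • u ^ 0 := by
      rw [hu, ← pow_mul, mul_comm, pow_mul, hζ]; simp
    rw [h3] at h2
    exact (add_right_cancel h2).symm
  have hz : ζ ^ t * ζ ^ (N - t) = 1 := by rw [← pow_add, Nat.add_sub_cancel' ht, hζ]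
  have main : u * ∑ j ∈ Finset.range N, ((ζ ^ (N - t)) ^ j) • u ^ j
      = ζ ^ t • ∑ j ∈ Finset.range N, ((ζ ^ (N - t)) ^ j) • u ^ j := by
    conv_rhs => rw [← key]
    rw [Finset.mul_sum, Finset.smul_sum]
    refine Finset.sum_congr rfl fun j _ => ?_
    rw [mul_smul_comm, smul_smul, ← pow_succ', pow_succ (ζ ^ (N - t)) j,
      mul_comm ((ζ ^ (N - t)) ^ j), ← mul_assoc, hz, one_mul]
  rw [cyclicIdem, mul_smul_comm, main, smul_comm]

theorem cyclicIdem_sum {N : ℕ} (hN : (N : k) ≠ 0) {ζ : k} (hζ : IsPrimitiveRoot ζ N) (u : H) :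
    ∑ t : Fin N, cyclicIdem N ζ u t = 1 := by
  have hpos : 0 < N := Nat.pos_of_ne_zero (by rintro rfl; simp at hN)
  unfold cyclicIdem
  rw [← Finset.smul_sum, Finset.sum_comm]
  have hin : ∀ j ∈ Finset.range N, ∑ t : Fin N, ((ζ ^ (N - (t : ℕ))) ^ j) • u ^ j
      = if j = 0 then (N : k) • (1 : H) else 0 := by
    intro j hj
    rw [← Finset.sum_smul]
    split_ifs with h0
    · subst h0; simp
    · have hj' : j < N := Finset.mem_range.mp hj
      have hne : ζ ^ j ≠ 1 := hζ.pow_ne_one_of_pos_of_lt h0 hj'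
      have e1 : ∑ t : Fin N, (ζ ^ (N - (t : ℕ))) ^ j = ζ ^ j * ∑ t ∈ Finset.range N, (ζ ^ j) ^ t := by
        rw [Finset.sum_range (fun t => (ζ ^ j) ^ t), Finset.mul_sum,
          ← Equiv.sum_comp Fin.revPerm (fun t : Fin N => ζ ^ j * (ζ ^ j) ^ (t : ℕ))]
        refine Finset.sum_congr rfl fun t _ => ?_
        rw [← pow_succ', ← pow_mul, ← pow_mul, mul_comm]
        congr 2
        simp [Fin.val_rev]
        omega
      have e2 := mul_geom_sum (ζ ^ j) N
      rw [← pow_mul, mul_comm j, pow_mul, hζ.pow_eq_one, one_pow, sub_self] at e2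
      rcases mul_eq_zero.mp e2 with h | h
      · exact absurd (sub_eq_zero.mp h) hne
      · rw [e1, h]; simp
  rw [Finset.sum_congr rfl hin, Finset.sum_ite_eq' (Finset.range N) 0]
  simp [hpos, smul_smul, hN]

theorem cyclicIdem_act {N : ℕ} (hN : (N : k) ≠ 0) {ζ : k} (hζ : IsPrimitiveRoot ζ N) {u x : H}
    {s t : ℕ} (hx : u * x = ζ ^ s • x) (hs : s < N) (ht : t < N) :
    cyclicIdem N ζ u t * x = (if t = s then (1 : k) else 0) • x := by
  have hp : ∀ j : ℕ, u ^ j * x = (ζ ^ s) ^ j • x := by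
    intro j
    induction j with
    | zero => simp
    | succ j ih => rw [pow_succ, mul_assoc, hx, mul_smul_comm, ih, smul_smul, pow_succ']
  have e1 : cyclicIdem N ζ u t * x
      = ((N : k)⁻¹ * ∑ j ∈ Finset.range N, (ζ ^ (N - t) * ζ ^ s) ^ j) • x := by
    unfold cyclicIdem
    rw [smul_mul_assoc, Finset.sum_mul, mul_smul, Finset.sum_smul]
    congr 1
    refine Finset.sum_congr rfl fun j _ => ?_
    rw [smul_mul_assoc, hp, smul_smul, ← mul_pow]
  rw [e1]
  congr 1
  split_ifs with h
  · subst h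
    rw [← pow_add, Nat.sub_add_cancel ht.le, hζ.pow_eq_one]
    simp [hN]
  · have hne : ζ ^ (N - t) * ζ ^ s ≠ 1 := by
      intro h1
      have h2 : ζ ^ s = ζ ^ t := by
        have : ζ ^ t * (ζ ^ (N - t) * ζ ^ s) = ζ ^ t := by rw [h1, mul_one]
        rwa [← mul_assoc, ← pow_add, Nat.add_sub_cancel' ht.le, hζ.pow_eq_one, one_mul] at this
      exact h (hζ.pow_inj hs ht h2).symm
    have e2 := mul_geom_sum (ζ ^ (N - t) * ζ ^ s) N
    have e3 : (ζ ^ (N - t) * ζ ^ s) ^ N = 1 := by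
      rw [mul_pow, ← pow_mul, ← pow_mul, mul_comm (N - t), mul_comm s, pow_mul, pow_mul,
        hζ.pow_eq_one]; simp
    rw [e3, sub_self] at e2
    rcases mul_eq_zero.mp e2 with h' | h'
    · exact absurd (sub_eq_zero.mp h') hne
    · rw [h', mul_zero]

theorem ofFn_prod_act {m : ℕ} (l : Fin m → H) (s : Fin m → k) (x : H)
    (h : ∀ i, l i * x = s i • x) : (List.ofFn l).prod * x = (∏ i, s i) • x := by
  induction m with
  | zero => simp
  | succ m ih =>
    rw [List.ofFn_succ, List.prod_cons, mul_assoc, ih _ (fun i => s i.succ) (fun i => h i.succ),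
      mul_smul_comm, h 0, smul_smul, Fin.prod_univ_succ, mul_comm]

theorem mul_ofFn_prod {m : ℕ} (l : Fin m → H) (x : H) (s : k) (i : Fin m)
    (hc : ∀ j, Commute x (l j)) (h : x * l i = s • l i) :
    x * (List.ofFn l).prod = s • (List.ofFn l).prod := by
  induction m with
  | zero => exact i.elim0
  | succ m ih =>
    rw [List.ofFn_succ, List.prod_cons]
    refine Fin.cases (fun h => ?_) (fun i h => ?_) i h
    · rw [← mul_assoc, h, smul_mul_assoc]
    · rw [← mul_assoc, (hc 0).eq, mul_assoc, ih _ i (fun j => hc j.succ) h, mul_smul_comm]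

theorem sum_ofFn_prod {m N : ℕ} (f : Fin m → Fin N → H) :
    ∑ b : Fin m → Fin N, (List.ofFn fun i => f i (b i)).prod
      = (List.ofFn fun i => ∑ t, f i t).prod := by
  induction m with
  | zero => simp
  | succ m ih =>
    rw [List.ofFn_succ, List.prod_cons, ← ih (fun i => f i.succ), Finset.sum_mul_sum,
      ← (Fin.consEquiv (fun _ : Fin (m + 1) => Fin N)).sum_comp, Fintype.sum_prod_type]
    refine Finset.sum_congr rfl fun t _ => Finset.sum_congr rfl fun b _ => ?_
    simp [Fin.consEquiv, List.ofFn_succ]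

end IdemLemmas

namespace QuantumBorel

variable {k : Type*} [Field k] {n : ℕ} {q : k} {m : ℕ} {C : CartanDatum m}
  {H : Type*} [Ring H] [HopfAlgebra k H] (D : QuantumBorel k n q C H)

/-- `h i = g i ^ n`. -/
def h (i : Fin m) : H := (D.g i : H) ^ n

/-- The primitive idempotents `1_a = 1^1_{a_1} ⋯ 1^m_{a_m}` of the group algebra of `(ℤ/n²)^m`,
`0 ≤ a_i < n²`. -/
noncomputable def idem (a : Fin m → ℕ) : H :=
  (List.ofFn fun i => cyclicIdem (n ^ 2) q (D.g i : H) (a i)).prod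

/-- The primitive idempotents of the group algebra of `⟨h_1, …, h_m⟩ ≅ (ℤ/n)^m`, `0 ≤ a_i < n`,
with respect to the primitive `n`-th root of unity `q ^ n`. -/
noncomputable def hIdem (a : Fin m → ℕ) : H :=
  (List.ofFn fun i => cyclicIdem n (q ^ n) (D.h i) (a i)).prod

/-! ### The twist and the quasi-Hopf algebra `A_q(𝔤)` -/

/-- `c(x, y) = q^{-x (y - y')}`, where `y'` is the remainder of `y` modulo `n`. -/
def twistScalar (_ : QuantumBorel k n q C H) (x y : ℕ) : k := (q ^ (x * (y - y % n)))⁻¹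

/-- The twist `J = ∑_{a, b ∈ (ℤ/n²)^m} ∏_{i, j} c(a_i, b_j)^{c_ij} 1_a ⊗ 1_b`. -/
noncomputable def J : H ⊗[k] H :=
  ∑ a : Fin m → Fin (n ^ 2), ∑ b : Fin m → Fin (n ^ 2),
    (∏ i, ∏ j, D.twistScalar (a i) (b j) ^ C.c i j) •
      (D.idem (fun i => a i) ⊗ₜ[k] D.idem (fun i => b i))

/-- The twisted comultiplication `Δ_J(x) = J Δ(x) J⁻¹` of `H_J`. -/
noncomputable def comulJ : H →ₗ[k] H ⊗[k] H :=
  LinearMap.mulLeft k D.J ∘ₗ LinearMap.mulRight k (Ring.inverse D.J) ∘ₗ Coalgebra.comul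

/-- The half small quasi-quantum group `A_q(𝔤)`: the subalgebra of `H` generated by the
`h i = g i ^ n` and the `e i`. -/
def A : Subalgebra k H := Algebra.adjoin k (Set.range D.h ∪ Set.range D.e)

/-- The inclusion `A ⊗ A → H ⊗ H`. -/
noncomputable def inclTensor : D.A ⊗[k] D.A →ₗ[k] H ⊗[k] H :=
  TensorProduct.map D.A.val.toLinearMap D.A.val.toLinearMap

theorem inclTensor_injective : Function.Injective D.inclTensor :=
  TensorProduct.map_injective_of_flat_flat _ _ Subtype.val_injective Subtype.val_injective

/-! The subspace `A` is stable under `Δ_J`; this is what is needed to define the comultiplication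
of `A`. -/

section Stable

variable {D}

theorem n_ne (D : QuantumBorel k n q C H) : n ≠ 0 := by have := D.two_le; omega

theorem natCast_ne (D : QuantumBorel k n q C H) : (n : k) ≠ 0 := by
  have : NeZero (n ^ 2) := ⟨pow_ne_zero _ (n_ne (D := D))⟩
  have h1 := D.prim.neZero' 
  have h2 := h1.ne
  push_cast at h2
  exact fun h => h2 (by rw [h]; simp)

theorem prim_n (D : QuantumBorel k n q C H) : IsPrimitiveRoot (q ^ n) n :=
  D.prim.pow (pow_pos (Nat.pos_of_ne_zero (n_ne (D := D))) _) (sq n)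

theorem q_ne (D : QuantumBorel k n q C H) : q ≠ 0 := by
  rintro rfl
  have h1 := D.prim.pow_eq_one
  rw [zero_pow (pow_ne_zero _ (n_ne (D := D)))] at h1
  exact zero_ne_one h1

theorem zpow_q_congr (D : QuantumBorel k n q C H) {x y : ℤ} (hxy : x ≡ y [ZMOD (n : ℤ) ^ 2]) : q ^ x = q ^ y := by
  obtain ⟨t, ht⟩ := hxy.dvd
  have : y = x + ((n ^ 2 : ℕ) : ℤ) * t := by push_cast; linarith
  rw [this, zpow_add₀ (q_ne (D := D)), zpow_mul, zpow_natCast, D.prim.pow_eq_one]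
  simp

variable (D) in
/-- `x` is a simultaneous eigenvector of left multiplication by the `g i`. -/
def HasWeight (w : Fin m → ℤ) (x : H) : Prop := ∀ i, (D.g i : H) * x = q ^ w i • x

/-- The residue of a weight. -/
def res (N : ℕ) (hN : N ≠ 0) (w : Fin m → ℤ) (i : Fin m) : Fin N :=
  ⟨(w i % N).toNat, by
    have h1 := Int.emod_nonneg (w i) (Int.natCast_ne_zero.mpr hN)
    have h2 := Int.emod_lt_of_pos (w i) (Int.natCast_pos.mpr (Nat.pos_of_ne_zero hN))
    omega⟩

theorem res_cast (N : ℕ) (hN : N ≠ 0) (w : Fin m → ℤ) (i : Fin m) :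
    ((res N hN w i : ℕ) : ℤ) = w i % N := by
  simp only [res]
  exact Int.toNat_of_nonneg (Int.emod_nonneg (w i) (Int.natCast_ne_zero.mpr hN))

theorem prod_indicator {N : ℕ} (a s : Fin m → Fin N) :
    (∏ i, if (a i : ℕ) = (s i : ℕ) then (1 : k) else 0) = if a = s then 1 else 0 := by
  rw [Finset.prod_ite_zero]
  simp [funext_iff, Fin.ext_iff]

theorem idem_act {w : Fin m → ℤ} {x : H} (hx : D.HasWeight w x) (a : Fin m → Fin (n ^ 2)) :
    D.idem (fun i => a i) * x
      = (if a = res (n ^ 2) (pow_ne_zero 2 (n_ne (D := D))) w then (1 : k) else 0) • x := by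
  rw [← prod_indicator]
  refine ofFn_prod_act _ _ _ fun i => cyclicIdem_act ?_ D.prim ?_ (Fin.is_lt _) (Fin.is_lt _)
  · push_cast; exact pow_ne_zero _ (natCast_ne (D := D))
  · rw [hx i, ← zpow_natCast, res_cast]
    congr 1
    refine zpow_q_congr (D := D) ?_
    push_cast
    exact (Int.mod_modEq _ _).symm

theorem hIdem_act {w : Fin m → ℤ} {x : H} (hx : D.HasWeight w x) (a : Fin m → Fin n) :
    D.hIdem (fun i => a i) * x
      = (if a = res n (n_ne (D := D)) w then (1 : k) else 0) • x := by
  rw [← prod_indicator]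
  refine ofFn_prod_act _ _ _ fun i => cyclicIdem_act (natCast_ne (D := D)) (prim_n (D := D)) ?_
    (Fin.is_lt _) (Fin.is_lt _)
  have hp : ∀ j : ℕ, (D.g i : H) ^ j * x = (q ^ w i) ^ j • x := by
    intro j
    induction j with
    | zero => simp
    | succ j ih => rw [pow_succ, mul_assoc, hx i, mul_smul_comm, ih, smul_smul, pow_succ']
  rw [h, hp, ← pow_mul, ← zpow_natCast, ← zpow_natCast, ← zpow_mul]
  congr 1
  refine zpow_q_congr (D := D) ?_
  push_cast
  rw [res_cast, mul_comm, sq]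
  exact Int.ModEq.mul_left' (Int.mod_modEq _ _).symm

theorem idem_weight (a : Fin m → Fin (n ^ 2)) :
    D.HasWeight (fun i => ((a i : ℕ) : ℤ)) (D.idem (fun i => a i)) := by
  intro i
  have hu : (D.g i : H) ^ (n ^ 2) = 1 := by
    rw [← Units.val_pow_eq_pow_val, D.g_pow, Units.val_one]
  refine mul_ofFn_prod _ _ _ i (fun j => ?_) ?_
  · have : Commute (D.g i : H) (D.g j : H) := congrArg Units.val (D.g_comm i j)
    unfold cyclicIdem
    exact (Commute.sum_right _ _ _ fun t _ => (this.pow_right t).smul_right _).smul_right _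
  · rw [zpow_natCast]
    exact cyclicIdem_eigen D.prim.pow_eq_one hu (Fin.is_lt _).le

theorem idem_sum : ∑ a : Fin m → Fin (n ^ 2), D.idem (fun i => a i) = 1 := by
  unfold idem
  rw [sum_ofFn_prod (fun i t => cyclicIdem (n ^ 2) q (D.g i : H) (t : ℕ))]
  have : (fun i : Fin m => ∑ t : Fin (n ^ 2), cyclicIdem (n ^ 2) q (D.g i : H) (t : ℕ))
      = fun _ => 1 := by
    funext i
    exact cyclicIdem_sum (by push_cast; exact pow_ne_zero _ (natCast_ne (D := D))) D.prim _
  rw [this]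
  simp

/-- An identity in `H ⊗ H` may be checked after multiplication by weight vectors. -/
theorem tensor_ext {L R : H ⊗[k] H}
    (hLR : ∀ w v x y, D.HasWeight w x → D.HasWeight v y → L * (x ⊗ₜ[k] y) = R * (x ⊗ₜ[k] y)) :
    L = R := by
  have h1 : (1 : H ⊗[k] H) = ∑ a : Fin m → Fin (n ^ 2), ∑ b : Fin m → Fin (n ^ 2),
      D.idem (fun i => a i) ⊗ₜ[k] D.idem (fun i => b i) := by
    rw [Algebra.TensorProduct.one_def]
    conv_lhs => rw [← idem_sum (D := D)]
    rw [TensorProduct.sum_tmul]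
    exact Finset.sum_congr rfl fun a _ => by rw [TensorProduct.tmul_sum]
  rw [← mul_one L, ← mul_one R, h1]
  simp only [Finset.mul_sum]
  exact Finset.sum_congr rfl fun a _ => Finset.sum_congr rfl fun b _ =>
    hLR _ _ _ _ (idem_weight a) (idem_weight b)

theorem diag_act (F : (Fin m → Fin (n ^ 2)) → (Fin m → Fin (n ^ 2)) → k) {w v : Fin m → ℤ}
    {x y : H} (hx : D.HasWeight w x) (hy : D.HasWeight v y) :
    (∑ a, ∑ b, F a b • (D.idem (fun i => a i) ⊗ₜ[k] D.idem (fun i => b i))) * (x ⊗ₜ[k] y)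
      = F (res (n ^ 2) (pow_ne_zero 2 (n_ne (D := D))) w)
          (res (n ^ 2) (pow_ne_zero 2 (n_ne (D := D))) v) • (x ⊗ₜ[k] y) := by
  simp only [Finset.sum_mul, smul_mul_assoc, Algebra.TensorProduct.tmul_mul_tmul, idem_act hx,
    idem_act hy]
  rw [Finset.sum_eq_single (res (n ^ 2) (pow_ne_zero 2 (n_ne (D := D))) w),
    Finset.sum_eq_single (res (n ^ 2) (pow_ne_zero 2 (n_ne (D := D))) v)]
  · simp
  · intro b _ hb; simp [hb]
  · simp
  · intro a _ ha; simp [ha]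
  · simp

theorem isUnit_J : IsUnit D.J := by
  have hne : ∀ a b : Fin m → Fin (n ^ 2),
      (∏ i, ∏ j, D.twistScalar (a i) (b j) ^ C.c i j) ≠ 0 := fun a b =>
    Finset.prod_ne_zero_iff.mpr fun i _ => Finset.prod_ne_zero_iff.mpr fun j _ =>
      zpow_ne_zero _ (inv_ne_zero (pow_ne_zero _ (q_ne (D := D))))
  refine isUnit_iff_exists.mpr ⟨∑ a : Fin m → Fin (n ^ 2), ∑ b : Fin m → Fin (n ^ 2),
    (∏ i, ∏ j, D.twistScalar (a i) (b j) ^ C.c i j)⁻¹ •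
      (D.idem (fun i => a i) ⊗ₜ[k] D.idem (fun i => b i)), ?_, ?_⟩ <;>
  · refine tensor_ext (D := D) fun w v x y hx hy => ?_
    rw [one_mul, mul_assoc, J,
      diag_act (fun a b => _) hx hy, mul_smul_comm, diag_act (fun a b => _) hx hy, smul_smul]
    first
      | rw [inv_mul_cancel₀ (hne _ _), one_smul]
      | rw [mul_inv_cancel₀ (hne _ _), one_smul]

theorem J_act {w v : Fin m → ℤ} {x y : H} (hx : D.HasWeight w x) (hy : D.HasWeight v y) :
    D.J * (x ⊗ₜ[k] y)
      = q ^ (-∑ i, ∑ j, C.c i j * (w i * (v j - v j % n))) • (x ⊗ₜ[k] y) := by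
  have hmod : ∀ j : Fin m, ∃ t : ℤ, v j % ((n ^ 2 : ℕ) : ℤ) = v j - (n : ℤ) ^ 2 * t := fun j =>
    ⟨v j / ((n ^ 2 : ℕ) : ℤ), by have := Int.mul_ediv_add_emod (v j) ((n ^ 2 : ℕ) : ℤ); push_cast at *; linarith⟩
  rw [J, diag_act (fun a b => _) hx hy]
  congr 1
  rw [← Finset.sum_neg_distrib]
  have hz : ∀ (s : Finset (Fin m)) (f : Fin m → ℤ), q ^ (∑ i ∈ s, f i) = ∏ i ∈ s, q ^ f i := by
    intro s f
    induction s using Finset.cons_induction with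
    | empty => simp
    | cons a s ha ih => rw [Finset.sum_cons, Finset.prod_cons, zpow_add₀ (q_ne (D := D)), ih]
  rw [hz]
  refine Finset.prod_congr rfl fun i _ => ?_
  rw [← Finset.sum_neg_distrib, hz]
  refine Finset.prod_congr rfl fun j _ => ?_
  rw [twistScalar, ← zpow_natCast, ← zpow_neg, ← zpow_mul]
  refine zpow_q_congr (D := D) ?_
  rw [Nat.cast_mul, Nat.cast_sub (Nat.mod_le _ _), Int.natCast_mod, res_cast, res_cast]
  have e1 : v j % ((n ^ 2 : ℕ) : ℤ) % (n : ℤ) = v j % n :=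
    Int.emod_emod_of_dvd _ (by push_cast; exact dvd_pow_self _ two_ne_zero)
  rw [e1]
  have e2 : w i % ((n ^ 2 : ℕ) : ℤ) ≡ w i [ZMOD (n : ℤ) ^ 2] := by
    push_cast; exact Int.mod_modEq _ _
  have e3 : v j % ((n ^ 2 : ℕ) : ℤ) ≡ v j [ZMOD (n : ℤ) ^ 2] := by
    push_cast; exact Int.mod_modEq _ _
  have e4 := ((e2.mul (e3.sub_right (v j % n))).neg).mul_right (C.c i j)
  refine e4.trans (congrArg (fun z : ℤ => z % (n : ℤ) ^ 2) ?_)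
  ring

variable (D) in
/-- The element `∑ a, f a 1_a` of the group algebra of the `h i`. -/
noncomputable def hDiag (f : (Fin m → Fin n) → k) : H :=
  ∑ a : Fin m → Fin n, f a • D.hIdem (fun i => a i)

theorem hDiag_act {w : Fin m → ℤ} {x : H} (hx : D.HasWeight w x) (f : (Fin m → Fin n) → k) :
    D.hDiag f * x = f (res n (n_ne (D := D)) w) • x := by
  simp only [hDiag, Finset.sum_mul, smul_mul_assoc, hIdem_act hx]
  rw [Finset.sum_eq_single (res n (n_ne (D := D)) w)]
  · simp
  · intro b _ hb; simp [hb]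
  · simp

theorem h_mem (i : Fin m) : D.h i ∈ D.A := Algebra.subset_adjoin (Or.inl ⟨i, rfl⟩)

theorem e_mem (i : Fin m) : D.e i ∈ D.A := Algebra.subset_adjoin (Or.inr ⟨i, rfl⟩)

theorem hIdem_mem (a : Fin m → ℕ) : D.hIdem a ∈ D.A := by
  refine Subalgebra.list_prod_mem _ fun x hx => ?_
  obtain ⟨i, rfl⟩ := List.mem_ofFn.mp hx
  exact Subalgebra.smul_mem _ (Subalgebra.sum_mem _ fun j _ =>
    Subalgebra.smul_mem _ (Subalgebra.pow_mem _ (h_mem i) _) _) _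

theorem hDiag_mem (f : (Fin m → Fin n) → k) : D.hDiag f ∈ D.A :=
  Subalgebra.sum_mem _ fun _ _ => Subalgebra.smul_mem _ (hIdem_mem _) _

theorem e_weight (i : Fin m) {w : Fin m → ℤ} {x : H} (hx : D.HasWeight w x) :
    D.HasWeight (w + Pi.single i 1) (D.e i * x) := by
  intro j
  have h1 : (D.g j : H) * D.e i = q ^ (if j = i then 1 else 0 : ℕ) • (D.e i * (D.g j : H)) := by
    rw [← smul_mul_assoc, ← D.g_e j i, mul_assoc, Units.inv_mul, mul_one]
  rw [← mul_assoc, h1, smul_mul_assoc, mul_assoc, hx j, mul_smul_comm, smul_smul, Pi.add_apply,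
    zpow_add₀ (q_ne (D := D)), mul_comm]
  congr 2
  by_cases hij : j = i
  · subst hij; simp
  · simp [hij]

theorem unitMonomial_act (b : Fin m → ℤ) {w : Fin m → ℤ} {x : H} (hx : D.HasWeight w x) :
    ((unitMonomial D.g b : Hˣ) : H) * x = q ^ (∑ j, b j * w j) • x := by
  have hq := q_ne (D := D)
  have hz : ∀ (s : Finset (Fin m)) (f : Fin m → ℤ), q ^ (∑ i ∈ s, f i) = ∏ i ∈ s, q ^ f i := by
    intro s f
    induction s using Finset.cons_induction with
    | empty => simp
    | cons a s ha ih => rw [Finset.sum_cons, Finset.prod_cons, zpow_add₀ hq, ih]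
  have hmap : ((unitMonomial D.g b : Hˣ) : H)
      = (List.ofFn fun i => ((D.g i ^ b i : Hˣ) : H)).prod := by
    rw [unitMonomial, ← Units.coeHom_apply, map_list_prod, List.map_ofFn]
    rfl
  rw [hmap, hz]
  refine ofFn_prod_act _ _ _ fun i => ?_
  have hinv : ((D.g i)⁻¹ : Hˣ) * x = q ^ (-w i) • x := by
    rw [Units.inv_mul_eq_iff_eq_mul, mul_smul_comm, hx i, smul_smul, ← zpow_add₀ hq]
    simp
  have hnat : ∀ (u : H) (s : k), u * x = s • x → ∀ t : ℕ, u ^ t * x = s ^ t • x := by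
    intro u s hu t
    induction t with
    | zero => simp
    | succ t ih => rw [pow_succ, mul_assoc, hu, mul_smul_comm, ih, smul_smul, pow_succ']
  obtain ⟨t, ht | ht⟩ := Int.eq_nat_or_neg (b i)
  · rw [ht, zpow_natCast, Units.val_pow_eq_pow_val, hnat _ _ (hx i), mul_comm, zpow_mul,
      zpow_natCast]
  · rw [ht, zpow_neg, zpow_natCast, ← inv_pow, Units.val_pow_eq_pow_val, hnat _ _ hinv,
      ← zpow_natCast, ← zpow_mul]
    congr 2
    ring

theorem comulJ_apply (x : H) :
    D.comulJ x = D.J * (Coalgebra.comul (R := k) x * Ring.inverse D.J) := rfl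

theorem comulJ_eq {x : H} {Y : H ⊗[k] H} (hY : D.J * Coalgebra.comul (R := k) x = Y * D.J) :
    D.comulJ x = Y := by
  rw [comulJ_apply, ← mul_assoc, hY, mul_assoc, Ring.mul_inverse_cancel _ isUnit_J, mul_one]

theorem comulJ_one : D.comulJ 1 = 1 := comulJ_eq (by simp)

theorem comulJ_mul (x y : H) : D.comulJ (x * y) = D.comulJ x * D.comulJ y := by
  refine comulJ_eq ?_
  simp only [comulJ_apply, mul_assoc, Bialgebra.comul_mul]
  rw [Ring.inverse_mul_cancel _ isUnit_J, mul_one, ← mul_assoc (Ring.inverse D.J),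
    Ring.inverse_mul_cancel _ isUnit_J, one_mul]

theorem comulJ_h (i : Fin m) : D.comulJ (D.h i) = D.h i ⊗ₜ[k] D.h i := by
  refine comulJ_eq ?_
  have hg : Coalgebra.comul (R := k) (D.h i) = D.h i ⊗ₜ[k] D.h i := by
    rw [h, Bialgebra.comul_pow, (D.g_groupLike i).comul_eq_tmul_self,
      Algebra.TensorProduct.tmul_pow]
  rw [hg]
  refine tensor_ext (D := D) fun w v x y hx hy => ?_
  have hh : ∀ {w : Fin m → ℤ} {x : H}, D.HasWeight w x → D.h i * x = (q ^ w i) ^ n • x := by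
    intro w x hx
    have : ∀ j : ℕ, (D.g i : H) ^ j * x = (q ^ w i) ^ j • x := by
      intro j
      induction j with
      | zero => simp
      | succ j ih => rw [pow_succ, mul_assoc, hx i, mul_smul_comm, ih, smul_smul, pow_succ']
    exact this n
  rw [mul_assoc, mul_assoc, J_act hx hy, mul_smul_comm, Algebra.TensorProduct.tmul_mul_tmul,
    hh hx, hh hy, TensorProduct.smul_tmul_smul, mul_smul_comm, J_act hx hy, smul_comm]

variable (D) in
/-- The element `Δ_J(e i)`. -/
noncomputable def comulE (i : Fin m) : H ⊗[k] H :=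
  D.e i ⊗ₜ[k] D.hDiag (fun a => q ^ (∑ t, C.c i t * (a t : ℤ)))
    + 1 ⊗ₜ[k] (D.hDiag (fun a => if (a i : ℕ) = 0 then 0 else 1) * D.e i)
    + D.hDiag (fun a => q ^ (-(n * ∑ s, C.c s i * (a s : ℤ)))) ⊗ₜ[k]
      (D.hDiag (fun a => if (a i : ℕ) = 0 then 1 else 0) * D.e i)

theorem comulJ_e (i : Fin m) : D.comulJ (D.e i) = D.comulE i := by
  have hq := q_ne (D := D)
  refine comulJ_eq (tensor_ext (D := D) fun w v x y hx hy => ?_)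
  rw [mul_assoc, mul_assoc, J_act hx hy, mul_smul_comm, D.comul_e i, add_mul, comulE, add_mul,
    add_mul]
  simp only [Algebra.TensorProduct.tmul_mul_tmul, one_mul, mul_assoc]
  have hev := e_weight i hy
  rw [unitMonomial_act _ hy, hDiag_act hy, hDiag_act hev, hDiag_act hx, hDiag_act hev, mul_add,
    TensorProduct.tmul_smul, mul_smul_comm, J_act (e_weight i hx) hy, J_act hx hev]
  simp only [TensorProduct.tmul_smul, ← TensorProduct.smul_tmul', smul_smul, res_cast]
  rw [smul_add, smul_add, add_assoc, smul_smul, smul_smul, smul_smul, ← add_smul]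
  congr 2
  · rw [← zpow_add₀ hq, ← zpow_add₀ hq]
    congr 1
    have : ∀ i₁, ∑ j, C.c i₁ j * ((w + Pi.single i 1 : Fin m → ℤ) i₁ * (v j - v j % n))
        = ∑ j, C.c i₁ j * (w i₁ * (v j - v j % n))
          + if i₁ = i then ∑ j, C.c i j * (v j - v j % n) else 0 := by
      intro i₁
      split_ifs with hi
      · subst hi
        rw [← Finset.sum_add_distrib]
        refine Finset.sum_congr rfl fun j _ => ?_
        simp only [Pi.add_apply, Pi.single_eq_same]
        ring
      · simp [hi]
    rw [Finset.sum_congr rfl fun i₁ _ => this i₁, Finset.sum_add_distrib, Finset.sum_ite_eq']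
    simp only [Finset.mem_univ, if_true, mul_sub, Finset.sum_sub_distrib]
    ring
  · have hr : (v i + 1) % n = ((res n (n_ne (D := D)) (v + Pi.single i 1) i : ℕ) : ℤ) := by
      rw [res_cast]; simp
    have hnpos : (2 : ℤ) ≤ n := by exact_mod_cast D.two_le
    obtain ⟨ε, hε, hε'⟩ : ∃ ε : ℤ, (v i + 1) - (v i + 1) % n = v i - v i % n + ε ∧
        ε = if (res n (n_ne (D := D)) (v + Pi.single i 1) i : ℕ) = 0 then (n : ℤ) else 0 := by
      refine ⟨_, (add_sub_cancel (v i - v i % n) _).symm, ?_⟩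
      have h1 := Int.emod_nonneg (v i) (by omega : (n : ℤ) ≠ 0)
      have h2 := Int.emod_lt_of_pos (v i) (by omega : (0 : ℤ) < n)
      have h3 : (v i + 1) % n = (v i % n + 1) % n := by rw [Int.emod_add_emod]
      by_cases h4 : v i % n + 1 < n
      · have h5 : (v i % n + 1) % n = v i % n + 1 := Int.emod_eq_of_lt (by omega) h4
        rw [h5] at h3
        rw [if_neg (by omega), h3]
        ring
      · have h5 : v i % n + 1 = n := by omega
        rw [h5, Int.emod_self] at h3
        rw [if_pos (by omega), h3]
        omega
    have key : ∀ i₁, ∑ j, C.c i₁ j * (w i₁ * ((v + Pi.single i 1 : Fin m → ℤ) j - (v + Pi.single i 1 : Fin m → ℤ) j % n))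
        = ∑ j, C.c i₁ j * (w i₁ * (v j - v j % n)) + C.c i₁ i * (w i₁ * ε) := by
      intro i₁
      have : ∀ j, C.c i₁ j * (w i₁ * ((v + Pi.single i 1 : Fin m → ℤ) j - (v + Pi.single i 1 : Fin m → ℤ) j % n))
          = C.c i₁ j * (w i₁ * (v j - v j % n)) + if j = i then C.c i₁ i * (w i₁ * ε) else 0 := by
        intro j
        split_ifs with hj
        · subst hj
          simp only [Pi.add_apply, Pi.single_eq_same]
          rw [hε]
          ring
        · simp [hj]
      rw [Finset.sum_congr rfl fun j _ => this j, Finset.sum_add_distrib, Finset.sum_ite_eq']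
      simp
    rw [Finset.sum_congr rfl fun i₁ _ => key i₁, Finset.sum_add_distrib, hε']
    split_ifs with h0
    · rw [mul_zero, zero_add, one_mul, ← zpow_add₀ hq]
      refine zpow_q_congr (D := D) ?_
      rw [neg_add]
      refine Int.ModEq.add_left _ (Int.ModEq.neg ?_)
      rw [Finset.mul_sum]
      have hterm : ∀ s, C.c s i * (w s * (n : ℤ)) ≡ n * (C.c s i * (w s % n)) [ZMOD (n : ℤ) ^ 2] := by
        intro s
        have h6 : (n : ℤ) * w s ≡ n * (w s % n) [ZMOD (n : ℤ) * n] :=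
          Int.ModEq.mul_left' (Int.mod_modEq _ _).symm
        have h7 := h6.mul_left (C.c s i)
        rw [← sq] at h7
        calc C.c s i * (w s * (n : ℤ)) = C.c s i * (n * w s) := by ring
          _ ≡ C.c s i * (n * (w s % n)) [ZMOD (n : ℤ) ^ 2] := h7
          _ = n * (C.c s i * (w s % n)) := by ring
      refine Int.ModEq.sum fun s _ => hterm s
    · simp

theorem comulJ_mem {x : H} (hx : x ∈ D.A) : D.comulJ x ∈ LinearMap.range D.inclTensor := by
  have hmul : ∀ y z, y ∈ LinearMap.range D.inclTensor → z ∈ LinearMap.range D.inclTensor →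
      y * z ∈ LinearMap.range D.inclTensor := by
    rintro _ _ ⟨y, rfl⟩ ⟨z, rfl⟩
    exact ⟨y * z, map_mul (Algebra.TensorProduct.map D.A.val D.A.val) y z⟩
  have ht : ∀ y z, y ∈ D.A → z ∈ D.A → y ⊗ₜ[k] z ∈ LinearMap.range D.inclTensor :=
    fun y z hy hz => ⟨⟨y, hy⟩ ⊗ₜ ⟨z, hz⟩, rfl⟩
  refine Algebra.adjoin_induction (p := fun x _ => D.comulJ x ∈ LinearMap.range D.inclTensor)
    ?_ ?_ ?_ ?_ hx
  · rintro x (⟨i, rfl⟩ | ⟨i, rfl⟩)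
    · rw [comulJ_h]; exact ht _ _ (h_mem i) (h_mem i)
    · rw [comulJ_e]
      refine Submodule.add_mem _ (Submodule.add_mem _ ?_ ?_) ?_
      · exact ht _ _ (e_mem i) (hDiag_mem _)
      · exact ht _ _ (one_mem _) (mul_mem (hDiag_mem _) (e_mem i))
      · exact ht _ _ (hDiag_mem _) (mul_mem (hDiag_mem _) (e_mem i))
  · intro r
    rw [Algebra.algebraMap_eq_smul_one, map_smul, comulJ_one]
    exact Submodule.smul_mem _ _ (ht _ _ (one_mem _) (one_mem _))
  · intro x y _ _ h1 h2
    rw [map_add]; exact Submodule.add_mem _ h1 h2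
  · intro x y _ _ h1 h2
    rw [comulJ_mul]; exact hmul _ _ h1 h2

end Stable

/-- The comultiplication `A → A ⊗ A` of `A_q(𝔤)`, the restriction of `Δ_J`. -/
noncomputable def comulA : D.A →ₗ[k] D.A ⊗[k] D.A :=
  (LinearEquiv.ofInjective D.inclTensor D.inclTensor_injective).symm.toLinearMap ∘ₗ
    LinearMap.codRestrict (LinearMap.range D.inclTensor) (D.comulJ ∘ₗ D.A.val.toLinearMap)
      (fun x => comulJ_mem x.2)

theorem inclTensor_comulA (x : D.A) : D.inclTensor (D.comulA x) = D.comulJ x := by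
  have := LinearEquiv.apply_symm_apply (LinearEquiv.ofInjective D.inclTensor D.inclTensor_injective)
    (LinearMap.codRestrict (LinearMap.range D.inclTensor) (D.comulJ ∘ₗ D.A.val.toLinearMap)
      (fun x => comulJ_mem x.2) x)
  exact congrArg Subtype.val this

/-! ### The dual `M_q(𝔤) = A_q(𝔤)^*` -/

/-- The unit of `M_q(𝔤)`: the counit of `A_q(𝔤)`. -/
noncomputable def dualOne : Module.Dual k D.A :=
  Coalgebra.counit ∘ₗ D.A.val.toLinearMap

/-- The (in general non-associative) product of `M_q(𝔤)`, dual to the comultiplication of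
`A_q(𝔤)`: `(φ · ψ)(x) = (φ ⊗ ψ)(Δ_J x)`. -/
noncomputable def dualMul (φ ψ : Module.Dual k D.A) : Module.Dual k D.A :=
  LinearMap.mul' k k ∘ₗ TensorProduct.map φ ψ ∘ₗ D.comulA

/-- The left-normed powers `(⋯((X · X) · X)⋯) · X` in `M_q(𝔤)`. -/
noncomputable def dualPow (X : Module.Dual k D.A) : ℕ → Module.Dual k D.A
  | 0 => D.dualOne
  | 1 => X
  | r + 2 => D.dualMul (dualPow X (r + 1)) X

end QuantumBorel

/-! The classical proof of the quantum Serre relations by skew derivations still works, because in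
the relevant degrees the associator is never felt. A functional on `A` is determined by its values
on monomials in the `h i` and by its left translates by the `e i` (`dual_ext`), so an identity in
the dual can be checked one translate at a time.

Since `Δ_J` is multiplicative, `Δ_J(e i)` tells how translation by `e i` acts on a product `φ · ψ`.
It has an ordinary skew-primitive part and a carry term, supported where the weight of the second
factor has `i`-th entry `0`. If `ψ` has a weight with entries below `n`, and either this entry is
nonzero or `e i` kills `ψ`, then translation by `e i` is a skew derivation on `φ · ψ`
(`translate_eA_dualMul`). Homogeneity of the basis and the choice of the idempotent `1_{ε_i}` show
that the translate of `Γ i` by `e j` is `δ_ij ε` (`isDualFamily_of_basis`).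

Put `N = -a_ij` and `Q = q^{d_i}`. Translating the Serre sum by `e i` gives a sum over `r + s = N`
whose coefficients cancel in pairs (`serre_coeff_succ`). Translating by `e j` removes `Γ j`, and the
remaining powers merge into `(Γ i)^{N+1}` with coefficient `∑ (-1)^s [N+1 choose s] Q^{-Ns} = 0`
(`alternating_sum_qBinomial`). Other translates vanish (`sum_smul_eq_zero`). All of this needs `N +
1 < n`; as `N ≤ 3` in finite type and `n ≥ 4`, this fails only for `n = 4`, `a_ij = -3`. The quantum
integers involved are then nonzero too. -/

/-! ### Gaussian binomials -/

/-- The quantum integer `[h]_d = (q^{dh} - q^{-dh}) / (q^d - q^{-d})`. -/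
noncomputable def qBracket {k : Type*} [Field k] (q : k) (d h : ℕ) : k :=
  (q ^ (d * h) - (q ^ (d * h))⁻¹) / (q ^ d - (q ^ d)⁻¹)

section QBinomial

variable {k : Type*} [Field k] {q : k} {d : ℕ}

theorem qFactorial_succ (N : ℕ) :
    qFactorial q d (N + 1) = qFactorial q d N * qBracket q d (N + 1) := by
  unfold qFactorial
  rw [Finset.prod_Icc_succ_top (by omega)]
  rfl

theorem qFactorial_ne_zero {N : ℕ} (hb : ∀ h, 1 ≤ h → h ≤ N → qBracket q d h ≠ 0) :
    qFactorial q d N ≠ 0 :=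
  Finset.prod_ne_zero_iff.mpr fun h hh =>
    hb h (Finset.mem_Icc.mp hh).1 (Finset.mem_Icc.mp hh).2

/-- Both sides equal `[N+1]! / ([r]! [s]!)`. -/
theorem qBinomial_mul_qBracket {N : ℕ} (hb : ∀ h, 1 ≤ h → h ≤ N + 1 → qBracket q d h ≠ 0)
    {r s : ℕ} (hrs : r + s = N) :
    qBinomial q d (N + 1) s * qBracket q d (r + 1)
      = qBinomial q d (N + 1) (s + 1) * qBracket q d (s + 1) := by
  have hF : ∀ t, t ≤ N + 1 → qFactorial q d t ≠ 0 := fun t ht =>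
    qFactorial_ne_zero fun h h1 h2 => hb h h1 (h2.trans ht)
  have e1 : N + 1 - s = r + 1 := by omega
  have e2 : N + 1 - (s + 1) = r := by omega
  have h1 := hF r (by omega)
  have h2 := hF s (by omega)
  have h3 := hb (r + 1) (by omega) (by omega)
  have h4 := hb (s + 1) (by omega) (by omega)
  rw [qBinomial, qBinomial, e1, e2, qFactorial_succ r, qFactorial_succ s]
  field_simp

/-- Division by zero gives `0`, so a nonvanishing bracket already certifies its denominator. -/
theorem sub_inv_ne_zero_of_qBracket (hb : qBracket q d 1 ≠ 0) : q ^ d - (q ^ d)⁻¹ ≠ 0 := by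
  intro h
  rw [qBracket, h, div_zero] at hb
  exact hb rfl

theorem geom_sum_eq_qBracket (hq : q ≠ 0) (hd : q ^ d - (q ^ d)⁻¹ ≠ 0) (r : ℕ) :
    ∑ t ∈ Finset.range (r + 1), ((q ^ d) ^ 2) ^ t = (q ^ d) ^ r * qBracket q d (r + 1) := by
  have hQ : q ^ d ≠ 0 := pow_ne_zero _ hq
  rw [qBracket, pow_mul]
  generalize q ^ d = Q at *
  have h1 : Q ^ 2 ≠ 1 := by
    intro h
    apply hd
    field_simp
    rw [h, sub_self, mul_zero]
  have h2 : Q ^ 2 - 1 ≠ 0 := sub_ne_zero.mpr h1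
  rw [geom_sum_eq h1]
  field_simp
  ring

/-- The coefficients of the quantum Serre relation are compatible with skew derivation by the
repeated generator. -/
theorem serre_coeff_succ (hq : q ≠ 0) {N : ℕ}
    (hb : ∀ h, 1 ≤ h → h ≤ N + 1 → qBracket q d h ≠ 0) {r s : ℕ} (hrs : r + s = N) :
    (-1) ^ s * qBinomial q d (N + 1) s * ((q ^ d) ^ 2) ^ s * ((q ^ d) ^ N)⁻¹
          * (∑ t ∈ Finset.range (r + 1), ((q ^ d) ^ 2) ^ t)
        + (-1) ^ (s + 1) * qBinomial q d (N + 1) (s + 1)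
          * (∑ t ∈ Finset.range (s + 1), ((q ^ d) ^ 2) ^ t) = 0 := by
  have hd := sub_inv_ne_zero_of_qBracket (hb 1 le_rfl (by omega))
  have hQ : q ^ d ≠ 0 := pow_ne_zero _ hq
  rw [geom_sum_eq_qBracket hq hd, geom_sum_eq_qBracket hq hd]
  have key := qBinomial_mul_qBracket hb hrs
  -- The exponent is `2s - N + r = s`, which matches the power of `Q` from the second geometric sum.
  have e : ((q ^ d) ^ 2) ^ s * ((q ^ d) ^ N)⁻¹ * (q ^ d) ^ r = (q ^ d) ^ s := by
    rw [← hrs]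
    generalize q ^ d = Q at *
    field_simp
    ring
  linear_combination (-1) ^ s * qBinomial q d (N + 1) s * qBracket q d (r + 1) * e
    + (-1) ^ s * (q ^ d) ^ s * key

/-- The increment that makes the alternating sum below telescope; only numerators are compared, so
the common denominator may be anything. -/
theorem qBracket_identity (hq : q ≠ 0) (s r : ℕ) :
    (q ^ d) ^ (s + 1) * qBracket q d (s + r + 1) - (q ^ d) ^ (s + r + 1) * qBracket q d (s + 1)
      = qBracket q d r := by
  have hQ : q ^ d ≠ 0 := pow_ne_zero _ hq
  simp only [qBracket, pow_mul]
  generalize q ^ d = Q at *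
  rw [mul_div_assoc', mul_div_assoc', ← sub_div]
  congr 1
  field_simp
  ring

/-- The vanishing of `∑ (-1)^s [N + 1 choose s] Q^{-Ns}`. -/
theorem alternating_sum_qBinomial (hq : q ≠ 0) {N : ℕ}
    (hb : ∀ h, 1 ≤ h → h ≤ N + 1 → qBracket q d h ≠ 0) :
    ∑ s ∈ Finset.range (N + 2),
      (-1) ^ s * qBinomial q d (N + 1) s * (((q ^ d) ^ N)⁻¹) ^ s = 0 := by
  have hQ : q ^ d ≠ 0 := pow_ne_zero _ hq
  -- Closed form of the partial sums, up to the factor `[N+1]`. The full sum is the case `r = 0`,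
  -- where `[0] = 0`.
  have key : ∀ s r, s + r = N + 1 → (∑ t ∈ Finset.range (s + 1),
      (-1) ^ t * qBinomial q d (N + 1) t * (((q ^ d) ^ N)⁻¹) ^ t) * qBracket q d (N + 1)
      = (-1) ^ s * qBinomial q d (N + 1) s * (((q ^ d) ^ (N + 1))⁻¹) ^ s * qBracket q d r := by
    intro s
    induction s with
    | zero =>
      intro r hr
      rw [zero_add] at hr
      subst hr
      simp
    | succ s ih =>
      intro r hr
      rw [Finset.sum_range_succ, add_mul, ih (r + 1) (by omega)]
      have h1 := qBinomial_mul_qBracket hb (show r + s = N by omega)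
      have h2 := qBracket_identity (q := q) (d := d) hq s r
      rw [show s + r + 1 = N + 1 by omega] at h2
      rw [← h2]
      have e1 : (((q ^ d) ^ (N + 1))⁻¹) ^ (s + 1) * (q ^ d) ^ (s + 1)
          = (((q ^ d) ^ N)⁻¹) ^ (s + 1) := by
        rw [← mul_pow, pow_succ (q ^ d) N, mul_inv, mul_assoc, inv_mul_cancel₀ hQ, mul_one]
      have e2 : (((q ^ d) ^ (N + 1))⁻¹) ^ (s + 1) * (q ^ d) ^ (N + 1)
          = (((q ^ d) ^ (N + 1))⁻¹) ^ s := by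
        rw [pow_succ, mul_assoc, inv_mul_cancel₀ (pow_ne_zero _ hQ), mul_one]
      linear_combination (-1) ^ s * (((q ^ d) ^ (N + 1))⁻¹) ^ s * h1
        + (-1) ^ s * qBinomial q d (N + 1) (s + 1) * qBracket q d (N + 1) * e1
        - (-1) ^ s * qBinomial q d (N + 1) (s + 1) * qBracket q d (s + 1) * e2
  have h0 := key (N + 1) 0 rfl
  have hz : qBracket q d 0 = 0 := by simp [qBracket]
  rw [hz, mul_zero] at h0
  exact (mul_eq_zero.mp h0).resolve_right (hb _ (by omega) le_rfl)

/-- `q^t = q^{-t}` exactly when the order of `q` divides `2t`; `h1` handles the denominator and `h2`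
the numerator. -/
theorem qBracket_ne_zero {N h : ℕ} (hq : IsPrimitiveRoot q N) (hN : N ≠ 0) (h1 : ¬ N ∣ 2 * d)
    (h2 : ¬ N ∣ 2 * (d * h)) : qBracket q d h ≠ 0 := by
  have hq0 : q ≠ 0 := hq.ne_zero hN
  have aux : ∀ t, ¬ N ∣ 2 * t → q ^ t - (q ^ t)⁻¹ ≠ 0 := by
    intro t ht h
    apply ht
    refine hq.dvd_of_pow_eq_one _ ?_
    rw [mul_comm, pow_mul, sq]
    nth_rewrite 2 [sub_eq_zero.mp h]
    exact mul_inv_cancel₀ (pow_ne_zero _ hq0)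
  exact div_ne_zero (aux _ h2) (aux _ h1)

end QBinomial

/-! ### Cartan matrices of finite type -/

namespace CartanDatum

variable {m : ℕ} (C : CartanDatum m)

theorem d_pos (i : Fin m) : 0 < C.d i := by
  rcases C.d_mem i with h | h | h <;> omega

/-- The symmetrized form takes the value `8 d_j - 2 d_i a_ij²` at `a_ij ε_i - 2 ε_j`. Positivity and
`d_i a_ij² = d_j a_ij a_ji` give the bound. -/
theorem mul_lt_four {i j : Fin m} (hij : i ≠ j) : C.a i j * C.a j i < 4 := by
  have hdi : (0 : ℝ) < C.d i := by exact_mod_cast C.d_pos i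
  have hdj : (0 : ℝ) < C.d j := by exact_mod_cast C.d_pos j
  have hs : (C.d i : ℝ) * C.a i j = C.d j * C.a j i := by exact_mod_cast C.symm i j
  have hii : (C.a i i : ℝ) = 2 := by rw [C.diag]; norm_num
  have hjj : (C.a j j : ℝ) = 2 := by rw [C.diag]; norm_num
  have hne : (Pi.single i (C.a i j : ℝ) - Pi.single j 2 : Fin m → ℝ) ≠ 0 := by
    intro h
    have := congrFun h j
    simp [hij.symm] at this
  have hpos := C.posDef.dotProduct_mulVec_pos hne
  simp only [star_trivial, Matrix.mulVec_sub, sub_dotProduct, dotProduct_sub,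
    Matrix.mulVec_single, single_dotProduct, Matrix.col_apply, Pi.smul_apply, Matrix.of_apply,
    MulOpposite.smul_eq_mul_unop, MulOpposite.unop_op, hii, hjj] at hpos
  rw [← hs] at hpos
  have h1 : (C.a i j : ℝ) * C.a j i < 4 := by
    have h2 : (C.d j : ℝ) * (C.a i j * C.a j i) = C.d i * (C.a i j) ^ 2 := by
      linear_combination -(C.a i j : ℝ) * hs
    nlinarith
  exact_mod_cast h1

theorem neg_three_le {i j : Fin m} (hij : i ≠ j) : -3 ≤ C.a i j := by
  by_contra h
  have h1 := C.nonpos j i hij.symm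
  have h2 : C.a j i ≠ 0 := fun h0 => by have := C.zero_symm j i h0; omega
  have h3 := C.mul_lt_four hij
  nlinarith [show C.a j i ≤ -1 by omega]

theorem c_comm (i j : Fin m) : C.c i j = C.c j i := C.symm i j

end CartanDatum

namespace QuantumBorel

variable {k : Type*} [Field k] {n : ℕ} {q : k} {m : ℕ} {C : CartanDatum m}
  {H : Type*} [Ring H] [HopfAlgebra k H] {D : QuantumBorel k n q C H}

/-! ### The algebra `A_q(𝔤)` -/

theorem g_mul_e (i j : Fin m) :
    (D.g i : H) * D.e j = q ^ (if i = j then 1 else 0 : ℕ) • (D.e j * (D.g i : H)) := by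
  rw [← smul_mul_assoc, ← D.g_e i j, mul_assoc, Units.inv_mul, mul_one]

theorem h_mul_e (i j : Fin m) :
    D.h i * D.e j = (q ^ n) ^ (if i = j then 1 else 0 : ℕ) • (D.e j * D.h i) := by
  have : ∀ t : ℕ, (D.g i : H) ^ t * D.e j
      = (q ^ t) ^ (if i = j then 1 else 0 : ℕ) • (D.e j * (D.g i : H) ^ t) := by
    intro t
    induction t with
    | zero => simp
    | succ t ih =>
      rw [pow_succ, mul_assoc, g_mul_e, mul_smul_comm, ← mul_assoc, ih, smul_mul_assoc, smul_smul,
        mul_assoc, pow_succ q, mul_pow, mul_comm]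
  exact this n

theorem h_pow (i : Fin m) : D.h i ^ n = 1 := by
  rw [h, ← pow_mul, ← sq, ← Units.val_pow_eq_pow_val, D.g_pow, Units.val_one]

theorem h_commute (i j : Fin m) : Commute (D.h i) (D.h j) := by
  have : Commute (D.g i : H) (D.g j : H) := congrArg Units.val (D.g_comm i j)
  exact this.pow_pow _ _

theorem h_mul_hIdem (a : Fin m → Fin n) (i : Fin m) :
    D.h i * D.hIdem (fun s => a s) = (q ^ n) ^ (a i : ℕ) • D.hIdem (fun s => a s) := by
  refine mul_ofFn_prod _ _ _ i (fun j => ?_) ?_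
  · unfold cyclicIdem
    exact (Commute.sum_right _ _ _ fun t _ =>
      ((h_commute i j).pow_right t).smul_right _).smul_right _
  · exact cyclicIdem_eigen (prim_n D).pow_eq_one (h_pow i) (Fin.is_lt _).le

theorem hIdem_mul_h (a : Fin m → Fin n) (i : Fin m) :
    D.hIdem (fun s => a s) * D.h i = (q ^ n) ^ (a i : ℕ) • D.hIdem (fun s => a s) := by
  rw [← h_mul_hIdem, hIdem]
  refine (Commute.list_prod_right _ _ fun x hx => ?_).symm.eq
  obtain ⟨j, rfl⟩ := List.mem_ofFn.mp hx
  unfold cyclicIdem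
  exact (Commute.sum_right _ _ _ fun t _ =>
    ((h_commute i j).pow_right t).smul_right _).smul_right _

theorem hIdem_sum : ∑ a : Fin m → Fin n, D.hIdem (fun s => a s) = 1 := by
  unfold hIdem
  rw [sum_ofFn_prod (fun i t => cyclicIdem n (q ^ n) (D.h i) (t : ℕ))]
  have : (fun i : Fin m => ∑ t : Fin n, cyclicIdem n (q ^ n) (D.h i) (t : ℕ)) = fun _ => 1 :=
    funext fun i => cyclicIdem_sum (natCast_ne D) (prim_n D) _
  rw [this]
  simp

variable (D) in
/-- `h i` as an element of `A_q(𝔤)`. -/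
def hA (i : Fin m) : D.A := ⟨D.h i, h_mem i⟩

variable (D) in
/-- `e i` as an element of `A_q(𝔤)`. -/
def eA (i : Fin m) : D.A := ⟨D.e i, e_mem i⟩

variable (D) in
/-- `hDiag f` as an element of `A_q(𝔤)`. -/
noncomputable def hDiagA (f : (Fin m → Fin n) → k) : D.A := ⟨D.hDiag f, hDiag_mem f⟩

variable (D) in
/-- The idempotent `1_a` as an element of `A_q(𝔤)`. -/
noncomputable def hIdemA (a : Fin m → Fin n) : D.A := ⟨D.hIdem (fun s => a s), hIdem_mem _⟩

theorem hA_mul_eA (i j : Fin m) :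
    D.hA i * D.eA j = (q ^ n) ^ (if i = j then 1 else 0 : ℕ) • (D.eA j * D.hA i) :=
  Subtype.ext (h_mul_e i j)

theorem hA_mul_hIdemA (a : Fin m → Fin n) (i : Fin m) :
    D.hA i * D.hIdemA a = (q ^ n) ^ (a i : ℕ) • D.hIdemA a := Subtype.ext (h_mul_hIdem a i)

theorem hIdemA_mul_hA (a : Fin m → Fin n) (i : Fin m) :
    D.hIdemA a * D.hA i = (q ^ n) ^ (a i : ℕ) • D.hIdemA a := Subtype.ext (hIdem_mul_h a i)

theorem hIdemA_sum : ∑ a : Fin m → Fin n, D.hIdemA a = 1 := by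
  refine Subtype.ext ?_
  rw [AddSubmonoidClass.coe_finsetSum]
  exact hIdem_sum

theorem hDiagA_eq_sum (f : (Fin m → Fin n) → k) : D.hDiagA f = ∑ a, f a • D.hIdemA a := by
  refine Subtype.ext ?_
  rw [AddSubmonoidClass.coe_finsetSum]
  rfl

variable (D) in
/-- The monoid generated by the `h i` and the `e i`. -/
def monomials : Submonoid D.A := Submonoid.closure (Set.range D.hA ∪ Set.range D.eA)

variable (D) in
/-- The monoid generated by the `h i`. -/
def hMonomials : Submonoid D.A := Submonoid.closure (Set.range D.hA)

theorem span_monomials : Submodule.span k (D.monomials : Set D.A) = ⊤ := by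
  have h1 : Algebra.adjoin k (Set.range D.hA ∪ Set.range D.eA) = ⊤ := by
    have h2 : (Subtype.val : D.A → H) ⁻¹' (Set.range D.h ∪ Set.range D.e)
        = Set.range D.hA ∪ Set.range D.eA := by
      ext x
      simp only [Set.mem_preimage, Set.mem_union, Set.mem_range, Subtype.ext_iff]
      rfl
    rw [← h2]
    exact Algebra.adjoin_adjoin_coe_preimage
  rw [monomials, ← Algebra.adjoin_eq_span, h1, Algebra.top_toSubmodule]

theorem hA_mem_hMonomials (i : Fin m) : D.hA i ∈ D.hMonomials :=
  Submonoid.subset_closure ⟨i, rfl⟩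

theorem hMonomials_le : D.hMonomials ≤ D.monomials :=
  Submonoid.closure_mono Set.subset_union_left

theorem eA_mem_monomials (i : Fin m) : D.eA i ∈ D.monomials :=
  Submonoid.subset_closure (Or.inr ⟨i, rfl⟩)

/-- Generators are adjoined on the left, the side on which translations act. -/
theorem monomials_induction {p : (x : D.A) → x ∈ D.monomials → Prop} (one : p 1 (one_mem _))
    (mul_h : ∀ i y (hy : y ∈ D.monomials), p y hy →
      p (D.hA i * y) (mul_mem (hMonomials_le (hA_mem_hMonomials i)) hy))
    (mul_e : ∀ i y (hy : y ∈ D.monomials), p y hy →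
      p (D.eA i * y) (mul_mem (eA_mem_monomials i) hy)) {x : D.A} (hx : x ∈ D.monomials) :
    p x hx := by
  refine Submonoid.closure_induction_left one ?_ hx
  rintro _ (⟨i, rfl⟩ | ⟨i, rfl⟩) y hy hp
  · exact mul_h i y hy hp
  · exact mul_e i y hy hp

theorem hMonomials_induction {p : (x : D.A) → x ∈ D.hMonomials → Prop} (one : p 1 (one_mem _))
    (mul_h : ∀ i y (hy : y ∈ D.hMonomials), p y hy →
      p (D.hA i * y) (mul_mem (hA_mem_hMonomials i) hy)) {x : D.A} (hx : x ∈ D.hMonomials) :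
    p x hx := by
  refine Submonoid.closure_induction_left one ?_ hx
  rintro _ ⟨i, rfl⟩ y hy hp
  exact mul_h i y hy hp

/-- A monomial in the `h i` and `e i` either involves no `e i`, or can be brought to a form in
which it begins with some `e i`. -/
theorem monomials_cases {x : D.A} (hx : x ∈ D.monomials) :
    x ∈ D.hMonomials ∨ ∃ (c : k) (i : Fin m) (y : D.A), y ∈ D.monomials ∧ x = c • (D.eA i * y) := by
  induction hx using monomials_induction with
  | one => exact Or.inl (one_mem _)
  | mul_h i y hy ih =>
    rcases ih with ih | ⟨c, j, z, hz, rfl⟩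
    · exact Or.inl (mul_mem (hA_mem_hMonomials i) ih)
    · refine Or.inr ⟨c * (q ^ n) ^ (if i = j then 1 else 0 : ℕ), j, D.hA i * z, mul_mem (hMonomials_le (hA_mem_hMonomials i)) hz, ?_⟩
      rw [mul_smul_comm, ← mul_assoc, hA_mul_eA, smul_mul_assoc, smul_smul, mul_assoc]
  | mul_e i y hy ih => exact Or.inr ⟨1, i, y, hy, by rw [one_smul]⟩

/-! ### Left translations of functionals -/

variable (D) in
/-- The functional `φ(x · -)`. -/
noncomputable def translate (x : D.A) : Module.Dual k D.A →ₗ[k] Module.Dual k D.A :=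
  (LinearMap.mulLeft k x).dualMap

@[simp] theorem translate_apply (x y : D.A) (φ : Module.Dual k D.A) :
    D.translate x φ y = φ (x * y) := rfl

theorem dual_ext_monomials {φ ψ : Module.Dual k D.A} (hφ : ∀ x ∈ D.monomials, φ x = ψ x) :
    φ = ψ :=
  LinearMap.ext_on span_monomials hφ

/-- A functional is determined by its restriction to the monomials in the `h i` and by its
translates by the `e i`. -/
theorem dual_ext {φ ψ : Module.Dual k D.A} (h0 : ∀ u ∈ D.hMonomials, φ u = ψ u)
    (he : ∀ i, D.translate (D.eA i) φ = D.translate (D.eA i) ψ) : φ = ψ := by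
  refine dual_ext_monomials fun x hx => ?_
  rcases monomials_cases hx with hx | ⟨c, i, y, -, rfl⟩
  · exact h0 x hx
  · rw [map_smul, map_smul, ← translate_apply, he i, translate_apply]

variable (D) in
/-- `ψ` is an eigenvector of weight `w` for the translations by the `h i`. -/
def HasDualWeight (w : Fin m → ℕ) (ψ : Module.Dual k D.A) : Prop :=
  ∀ i, D.translate (D.hA i) ψ = (q ^ n) ^ w i • ψ

/-- Distinct exponents below `n` give distinct eigenvalues of the `h i`, so a functional of weight
`w` kills `1_a A` for `a ≠ w`, and `∑ f(a) 1_a` acts by `f(w)`. -/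
theorem HasDualWeight.translate_hDiagA {w : Fin m → ℕ} {ψ : Module.Dual k D.A}
    (hψ : D.HasDualWeight w ψ) (hw : ∀ i, w i < n) (f : (Fin m → Fin n) → k) :
    D.translate (D.hDiagA f) ψ = f (fun i => ⟨w i, hw i⟩) • ψ := by
  ext y
  have h0 : ∀ a, a ≠ (fun i => ⟨w i, hw i⟩) → ψ (D.hIdemA a * y) = 0 := by
    intro a ha
    obtain ⟨i, hi⟩ := Function.ne_iff.mp ha
    have h1 := LinearMap.congr_fun (hψ i) (D.hIdemA a * y)
    rw [translate_apply, ← mul_assoc, hA_mul_hIdemA, smul_mul_assoc, map_smul,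
      LinearMap.smul_apply] at h1
    by_contra hne
    have h2 := (prim_n D).pow_inj (Fin.is_lt _) (hw i) (mul_right_cancel₀ hne h1)
    exact hi (Fin.ext h2)
  have h1 : ψ (D.hIdemA (fun i => ⟨w i, hw i⟩) * y) = ψ y := by
    conv_rhs => rw [← one_mul y, ← hIdemA_sum, Finset.sum_mul, map_sum]
    exact (Finset.sum_eq_single _ (fun a _ ha => h0 a ha) (by simp)).symm
  rw [translate_apply, hDiagA_eq_sum, Finset.sum_mul, map_sum,
    Finset.sum_eq_single (fun i => ⟨w i, hw i⟩)]
  · rw [smul_mul_assoc, map_smul, h1, LinearMap.smul_apply]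
  · intro a _ ha
    rw [smul_mul_assoc, map_smul, h0 a ha, smul_zero]
  · simp

/-! ### The product of the dual -/

theorem comulA_mul (x y : D.A) : D.comulA (x * y) = D.comulA x * D.comulA y := by
  refine D.inclTensor_injective ?_
  have hm : ∀ s t, D.inclTensor (s * t) = D.inclTensor s * D.inclTensor t :=
    map_mul (Algebra.TensorProduct.map D.A.val D.A.val)
  rw [hm, inclTensor_comulA, inclTensor_comulA, inclTensor_comulA, ← comulJ_mul]
  rfl

theorem comulA_one : D.comulA 1 = 1 := by
  refine D.inclTensor_injective ?_
  rw [inclTensor_comulA]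
  exact comulJ_one

theorem comulA_hA (i : Fin m) : D.comulA (D.hA i) = D.hA i ⊗ₜ[k] D.hA i := by
  refine D.inclTensor_injective ?_
  rw [inclTensor_comulA]
  exact comulJ_h i

theorem comulA_eA (i : Fin m) : D.comulA (D.eA i) =
    D.eA i ⊗ₜ[k] D.hDiagA (fun a => q ^ (∑ t, C.c i t * (a t : ℤ)))
    + 1 ⊗ₜ[k] (D.hDiagA (fun a => if (a i : ℕ) = 0 then 0 else 1) * D.eA i)
    + D.hDiagA (fun a => q ^ (-(n * ∑ s, C.c s i * (a s : ℤ)))) ⊗ₜ[k]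
      (D.hDiagA (fun a => if (a i : ℕ) = 0 then 1 else 0) * D.eA i) := by
  refine D.inclTensor_injective ?_
  rw [inclTensor_comulA]
  exact comulJ_e i

/-- Left multiplication on `A ⊗ A` dualizes to translation of each factor; with multiplicativity of
`Δ_J` this turns the coproduct of a generator into a rule for translating products. -/
theorem pairing_tmul_mul (φ ψ : Module.Dual k D.A) (x y : D.A) (T : D.A ⊗[k] D.A) :
    LinearMap.mul' k k (TensorProduct.map φ ψ (x ⊗ₜ[k] y * T))
      = LinearMap.mul' k k (TensorProduct.map (D.translate x φ) (D.translate y ψ) T) := by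
  induction T with
  | zero => simp
  | tmul s t => simp
  | add s t hs ht => rw [mul_add, map_add, map_add, hs, ht, map_add, map_add]

theorem dualMul_apply (φ ψ : Module.Dual k D.A) (x : D.A) :
    D.dualMul φ ψ x = LinearMap.mul' k k (TensorProduct.map φ ψ (D.comulA x)) := rfl

theorem dualMul_smul_left (c : k) (φ ψ : Module.Dual k D.A) :
    D.dualMul (c • φ) ψ = c • D.dualMul φ ψ := by
  ext x; simp [dualMul_apply, TensorProduct.map_smul_left]

theorem dualMul_smul_right (c : k) (φ ψ : Module.Dual k D.A) :
    D.dualMul φ (c • ψ) = c • D.dualMul φ ψ := by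
  ext x; simp [dualMul_apply, TensorProduct.map_smul_right]

theorem dualMul_zero_left (ψ : Module.Dual k D.A) : D.dualMul 0 ψ = 0 := by
  ext x; simp [dualMul_apply]

theorem dualMul_zero_right (φ : Module.Dual k D.A) : D.dualMul φ 0 = 0 := by
  ext x; simp [dualMul_apply]

theorem translate_hA_dualMul (φ ψ : Module.Dual k D.A) (i : Fin m) :
    D.translate (D.hA i) (D.dualMul φ ψ)
      = D.dualMul (D.translate (D.hA i) φ) (D.translate (D.hA i) ψ) := by
  ext y
  rw [translate_apply, dualMul_apply, comulA_mul, comulA_hA, pairing_tmul_mul]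
  rfl

theorem translate_mul (x y : D.A) (φ : Module.Dual k D.A) :
    D.translate (x * y) φ = D.translate y (D.translate x φ) := by
  ext z; simp [mul_assoc]

/-- Hypothesis `hi` removes the carry term of `Δ_J(e i)`: either its projector onto `a_i = 0` kills
`ψ`, or `e i` does. What remains is a skew Leibniz rule. -/
theorem translate_eA_dualMul (φ : Module.Dual k D.A) {ψ : Module.Dual k D.A} {w : Fin m → ℕ}
    (hψ : D.HasDualWeight w ψ) (hw : ∀ t, w t < n) (i : Fin m)
    (hi : w i ≠ 0 ∨ D.translate (D.eA i) ψ = 0) :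
    D.translate (D.eA i) (D.dualMul φ ψ)
      = q ^ (∑ t, C.c i t * (w t : ℤ)) • D.dualMul (D.translate (D.eA i) φ) ψ
        + D.dualMul φ (D.translate (D.eA i) ψ) := by
  have key : D.translate (D.eA i) (D.dualMul φ ψ)
      = D.dualMul (D.translate (D.eA i) φ)
          (D.translate (D.hDiagA (fun a => q ^ (∑ t, C.c i t * (a t : ℤ)))) ψ)
        + D.dualMul φ (D.translate
          (D.hDiagA (fun a => if (a i : ℕ) = 0 then 0 else 1) * D.eA i) ψ)
        + D.dualMul (D.translate (D.hDiagA (fun a => q ^ (-(n * ∑ s, C.c s i * (a s : ℤ))))) φ)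
          (D.translate (D.hDiagA (fun a => if (a i : ℕ) = 0 then 1 else 0) * D.eA i) ψ) := by
    ext y
    rw [translate_apply, dualMul_apply, comulA_mul, comulA_eA, add_mul, add_mul, map_add, map_add,
      map_add, map_add, pairing_tmul_mul, pairing_tmul_mul, pairing_tmul_mul]
    simp only [LinearMap.add_apply, dualMul_apply]
    congr 6
    ext z
    simp
  -- Translation reverses products, so the projectors meet `ψ` before `e i` does and are evaluated
  -- at its own weight `w`.
  rw [key, translate_mul, translate_mul, hψ.translate_hDiagA hw, hψ.translate_hDiagA hw,
    hψ.translate_hDiagA hw, dualMul_smul_right, map_smul, map_smul]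
  dsimp only
  rcases hi with hi | hi
  · rw [if_neg hi, if_neg hi, one_smul, zero_smul, dualMul_zero_right, add_zero]
  · rw [hi, smul_zero, smul_zero, dualMul_zero_right, dualMul_zero_right, add_zero]

theorem HasDualWeight.dualMul {w v : Fin m → ℕ} {φ ψ : Module.Dual k D.A}
    (hφ : D.HasDualWeight w φ) (hψ : D.HasDualWeight v ψ) :
    D.HasDualWeight (w + v) (D.dualMul φ ψ) := by
  intro i
  rw [translate_hA_dualMul, hφ i, hψ i, dualMul_smul_left, dualMul_smul_right, smul_smul,
    Pi.add_apply, pow_add]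

/-- Monomials in the `h i` remain grouplike for `Δ_J`. -/
theorem dualMul_apply_hMonomials (φ ψ : Module.Dual k D.A) {u : D.A} (hu : u ∈ D.hMonomials) :
    D.dualMul φ ψ u = φ u * ψ u := by
  have : D.comulA u = u ⊗ₜ[k] u := by
    induction hu using hMonomials_induction with
    | one => exact comulA_one
    | mul_h i y hy ih => rw [comulA_mul, comulA_hA, ih, Algebra.TensorProduct.tmul_mul_tmul]
  rw [dualMul_apply, this]
  simp

/-! ### The counit -/

theorem counit_h (i : Fin m) : Coalgebra.counit (R := k) (D.h i) = 1 := by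
  have h1 : Coalgebra.counit (R := k) (D.g i : H) = 1 := (D.g_groupLike i).counit_eq_one
  rw [h, ← Bialgebra.counitAlgHom_apply, map_pow, Bialgebra.counitAlgHom_apply, h1, one_pow]

/-- The counit axiom leaves `ε(e i) K i = 0`, and `K i` is invertible. -/
theorem counit_e (i : Fin m) : Coalgebra.counit (R := k) (D.e i) = 0 := by
  have h1 := Coalgebra.rTensor_counit_comul (R := k) (D.e i)
  rw [D.comul_e i, map_add, LinearMap.rTensor_tmul, LinearMap.rTensor_tmul,
    Bialgebra.counit_one] at h1
  have h2 := congrArg (TensorProduct.lid k H) (add_eq_right.mp h1)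
  rw [TensorProduct.lid_tmul, map_zero] at h2
  have h3 := congrArg (· * (((unitMonomial D.g (C.c i))⁻¹ : Hˣ) : H)) h2
  simp only [smul_mul_assoc, Units.mul_inv, zero_mul] at h3
  have h4 := congrArg (Coalgebra.counit (R := k)) h3
  simpa using h4

theorem translate_hA_dualOne (i : Fin m) : D.translate (D.hA i) D.dualOne = D.dualOne := by
  ext y
  change Coalgebra.counit (R := k) (D.h i * (y : H)) = Coalgebra.counit (R := k) (y : H)
  rw [Bialgebra.counit_mul, counit_h, one_mul]

theorem translate_eA_dualOne (i : Fin m) : D.translate (D.eA i) D.dualOne = 0 := by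
  ext y
  change Coalgebra.counit (R := k) (D.e i * (y : H)) = 0
  rw [Bialgebra.counit_mul, counit_e, zero_mul]

theorem dualOne_one : D.dualOne 1 = 1 := Bialgebra.counit_one

theorem dualOne_apply_hMonomials {u : D.A} (hu : u ∈ D.hMonomials) : D.dualOne u = 1 := by
  induction hu using hMonomials_induction with
  | one => exact dualOne_one
  | mul_h i y hy ih => rw [← translate_apply, translate_hA_dualOne, ih]

theorem hasDualWeight_dualOne : D.HasDualWeight 0 D.dualOne := by
  intro i
  rw [translate_hA_dualOne, Pi.zero_apply, pow_zero, one_smul]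

theorem dualMul_dualOne (φ : Module.Dual k D.A) : D.dualMul φ D.dualOne = φ := by
  refine dual_ext_monomials fun x hx => ?_
  induction hx using monomials_induction generalizing φ with
  | one => rw [dualMul_apply_hMonomials _ _ (one_mem _), dualOne_one, mul_one]
  | mul_h i y hy ih =>
    rw [← translate_apply, translate_hA_dualMul, translate_hA_dualOne, ih, translate_apply]
  | mul_e i y hy ih =>
    rw [← translate_apply, translate_eA_dualMul φ hasDualWeight_dualOne
      (fun _ => Nat.pos_of_ne_zero (n_ne D)) i (Or.inr (translate_eA_dualOne i)),
      translate_eA_dualOne, dualMul_zero_right]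
    simp only [Pi.zero_apply, Nat.cast_zero, mul_zero, Finset.sum_const_zero, zpow_zero, one_smul,
      add_zero]
    rw [ih, translate_apply]

end QuantumBorel

namespace QuantumBorel

variable {k : Type*} [Field k] {n : ℕ} {q : k} {m : ℕ} {C : CartanDatum m}
  {H : Type*} [Ring H] [HopfAlgebra k H] {D : QuantumBorel k n q C H}

/-! ### Functionals dual to the generators `e i` -/

theorem translate_smul (c : k) (x : D.A) (φ : Module.Dual k D.A) :
    D.translate (c • x) φ = c • D.translate x φ := by
  ext y; simp

variable (D) in
/-- The functionals `Γ i` are dual to the generators `e i` in the sense of skew derivations: they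
vanish on the monomials in the `h j`, and `Γ i (e j * -)` is `δ_ij ε`. -/
structure IsDualFamily (Γ : Fin m → Module.Dual k D.A) : Prop where
  apply_hMonomials : ∀ i, ∀ u ∈ D.hMonomials, Γ i u = 0
  translate_self : ∀ i, D.translate (D.eA i) (Γ i) = D.dualOne
  translate_ne : ∀ i j, i ≠ j → D.translate (D.eA j) (Γ i) = 0

theorem single_lt (i : Fin m) {r : ℕ} (hr : r < n) (t : Fin m) :
    (Pi.single i r : Fin m → ℕ) t < n := by
  rw [Pi.single_apply]
  split_ifs <;> omega

theorem sum_mul_single (i l : Fin m) (r : ℕ) :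
    ∑ t, C.c l t * ((Pi.single i r : Fin m → ℕ) t : ℤ) = C.c l i * r := by
  simp [Pi.single_apply]

namespace IsDualFamily

variable {Γ : Fin m → Module.Dual k D.A}

/-- `ε` is invariant under the `h l`, so the weight comes only from commuting `h l` past `e i`. -/
theorem hasDualWeight (hΓ : D.IsDualFamily Γ) (i : Fin m) :
    D.HasDualWeight (Pi.single i 1) (Γ i) := by
  intro l
  refine dual_ext (fun u hu => ?_) fun j => ?_
  · rw [translate_apply, LinearMap.smul_apply, hΓ.apply_hMonomials i u hu,
      hΓ.apply_hMonomials i _ (mul_mem (hA_mem_hMonomials l) hu), smul_zero]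
  · rw [← translate_mul, hA_mul_eA, map_smul, translate_smul, translate_mul]
    by_cases hij : i = j
    · subst hij
      rw [hΓ.translate_self, translate_hA_dualOne, Pi.single_apply]
    · rw [hΓ.translate_ne i j hij, map_zero, smul_zero, smul_zero]

/-- Left translation of `φ · Γ i` by `e i`. -/
theorem translate_dualMul_self (hΓ : D.IsDualFamily Γ) (φ : Module.Dual k D.A) (i : Fin m) :
    D.translate (D.eA i) (D.dualMul φ (Γ i))
      = q ^ C.c i i • D.dualMul (D.translate (D.eA i) φ) (Γ i) + φ := by
  rw [translate_eA_dualMul φ (hΓ.hasDualWeight i)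
    (single_lt i (by have := D.two_le; omega)) i (Or.inl (by simp)), sum_mul_single,
    hΓ.translate_self, dualMul_dualOne, Nat.cast_one, mul_one]

/-- Left translation of `φ · Γ i` by `e l` for `l ≠ i`. -/
theorem translate_dualMul_ne (hΓ : D.IsDualFamily Γ) (φ : Module.Dual k D.A) {i l : Fin m}
    (hil : i ≠ l) :
    D.translate (D.eA l) (D.dualMul φ (Γ i))
      = q ^ C.c l i • D.dualMul (D.translate (D.eA l) φ) (Γ i) := by
  rw [translate_eA_dualMul φ (hΓ.hasDualWeight i)
    (single_lt i (by have := D.two_le; omega)) l (Or.inr (hΓ.translate_ne i l hil)),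
    sum_mul_single, hΓ.translate_ne i l hil, dualMul_zero_right, add_zero, Nat.cast_one, mul_one]

theorem dualOne_dualMul (hΓ : D.IsDualFamily Γ) (i : Fin m) :
    D.dualMul D.dualOne (Γ i) = Γ i := by
  refine dual_ext (fun u hu => ?_) fun l => ?_
  · rw [dualMul_apply_hMonomials _ _ hu, hΓ.apply_hMonomials i u hu, mul_zero]
  · by_cases hil : i = l
    · subst hil
      rw [hΓ.translate_dualMul_self, translate_eA_dualOne, dualMul_zero_left, smul_zero, zero_add,
        hΓ.translate_self]
    · rw [hΓ.translate_dualMul_ne _ hil, translate_eA_dualOne, dualMul_zero_left, smul_zero,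
        hΓ.translate_ne i l hil]

/-! ### Left-normed powers and the Serre sum -/

theorem dualPow_succ (hΓ : D.IsDualFamily Γ) (i : Fin m) (r : ℕ) :
    D.dualPow (Γ i) (r + 1) = D.dualMul (D.dualPow (Γ i) r) (Γ i) := by
  cases r with
  | zero => exact (hΓ.dualOne_dualMul i).symm
  | succ r => rfl

theorem hasDualWeight_dualPow (hΓ : D.IsDualFamily Γ) (i : Fin m) (r : ℕ) :
    D.HasDualWeight (Pi.single i r) (D.dualPow (Γ i) r) := by
  induction r with
  | zero =>
    rw [Pi.single_zero]
    exact hasDualWeight_dualOne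
  | succ r ih =>
    rw [hΓ.dualPow_succ, Pi.single_add]
    exact ih.dualMul (hΓ.hasDualWeight i)

theorem dualPow_apply_hMonomials (hΓ : D.IsDualFamily Γ) (i : Fin m) (r : ℕ) {u : D.A}
    (hu : u ∈ D.hMonomials) : D.dualPow (Γ i) r u = if r = 0 then 1 else 0 := by
  cases r with
  | zero => rw [if_pos rfl]; exact dualOne_apply_hMonomials hu
  | succ r =>
    rw [hΓ.dualPow_succ, dualMul_apply_hMonomials _ _ hu, hΓ.apply_hMonomials i u hu, mul_zero,
      if_neg r.succ_ne_zero]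

/-- No bound on `r` is needed: the rightmost factor `Γ i` always has weight `1`. At `r = 0` the
truncated exponent carries coefficient zero. -/
theorem translate_dualPow_self (hΓ : D.IsDualFamily Γ) (i : Fin m) (r : ℕ) :
    D.translate (D.eA i) (D.dualPow (Γ i) r)
      = (∑ t ∈ Finset.range r, (q ^ C.c i i) ^ t) • D.dualPow (Γ i) (r - 1) := by
  induction r with
  | zero =>
    rw [Finset.sum_range_zero, zero_smul]
    exact translate_eA_dualOne i
  | succ r ih =>
    rw [hΓ.dualPow_succ, hΓ.translate_dualMul_self, ih, dualMul_smul_left, smul_smul,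
      geom_sum_succ, add_smul, one_smul, Nat.add_sub_cancel]
    cases r with
    | zero => simp
    | succ r => rw [Nat.add_sub_cancel, ← hΓ.dualPow_succ]

theorem translate_dualPow_ne (hΓ : D.IsDualFamily Γ) {i l : Fin m} (hil : i ≠ l) (r : ℕ) :
    D.translate (D.eA l) (D.dualPow (Γ i) r) = 0 := by
  induction r with
  | zero => exact translate_eA_dualOne l
  | succ r ih =>
    rw [hΓ.dualPow_succ, hΓ.translate_dualMul_ne _ hil, ih, dualMul_zero_left, smul_zero]

/-- Left translation of `φ · (Γ i)^s` by `e i`. -/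
theorem translate_dualMul_dualPow_self (hΓ : D.IsDualFamily Γ) (φ : Module.Dual k D.A) (i : Fin m)
    {s : ℕ} (hs : s < n) :
    D.translate (D.eA i) (D.dualMul φ (D.dualPow (Γ i) s))
      = (q ^ C.c i i) ^ s • D.dualMul (D.translate (D.eA i) φ) (D.dualPow (Γ i) s)
        + (∑ t ∈ Finset.range s, (q ^ C.c i i) ^ t)
          • D.dualMul φ (D.dualPow (Γ i) (s - 1)) := by
  -- The carry term could matter only for `s = 0`, when the power is `ε` and is killed by `e i`.
  have h0 : (Pi.single i s : Fin m → ℕ) i ≠ 0 ∨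
      D.translate (D.eA i) (D.dualPow (Γ i) s) = 0 := by
    rcases Nat.eq_zero_or_pos s with rfl | hs'
    · exact Or.inr (translate_eA_dualOne i)
    · exact Or.inl (by rw [Pi.single_eq_same]; omega)
  rw [translate_eA_dualMul φ (hΓ.hasDualWeight_dualPow i s) (single_lt i hs) i h0, sum_mul_single,
    hΓ.translate_dualPow_self, dualMul_smul_right, zpow_mul, zpow_natCast]

/-- Left translation of `φ · (Γ i)^s` by `e l` for `l ≠ i`. -/
theorem translate_dualMul_dualPow_ne (hΓ : D.IsDualFamily Γ) (φ : Module.Dual k D.A)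
    {i l : Fin m} (hil : i ≠ l) {s : ℕ} (hs : s < n) :
    D.translate (D.eA l) (D.dualMul φ (D.dualPow (Γ i) s))
      = (q ^ C.c l i) ^ s • D.dualMul (D.translate (D.eA l) φ) (D.dualPow (Γ i) s) := by
  rw [translate_eA_dualMul φ (hΓ.hasDualWeight_dualPow i s) (single_lt i hs) l
    (Or.inr (hΓ.translate_dualPow_ne hil s)), sum_mul_single, hΓ.translate_dualPow_ne hil,
    dualMul_zero_right, add_zero, zpow_mul, zpow_natCast]

/-- The left-normed powers multiply as in an associative algebra as long as the second exponent is
smaller than `n`. -/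
theorem dualPow_add (hΓ : D.IsDualFamily Γ) (i : Fin m) (r s : ℕ) (hs : s < n) :
    D.dualMul (D.dualPow (Γ i) r) (D.dualPow (Γ i) s) = D.dualPow (Γ i) (r + s) := by
  induction h : r + s generalizing r s with
  | zero =>
    obtain ⟨rfl, rfl⟩ : r = 0 ∧ s = 0 := by omega
    exact dualMul_dualOne _
  | succ N ih =>
    refine dual_ext (fun u hu => ?_) fun l => ?_
    · rw [dualMul_apply_hMonomials _ _ hu]
      simp only [hΓ.dualPow_apply_hMonomials i _ hu]
      by_cases hr : r = 0
      · rw [if_neg (by omega : s ≠ 0), mul_zero, if_neg N.succ_ne_zero]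
      · rw [if_neg hr, zero_mul, if_neg N.succ_ne_zero]
    · by_cases hil : i = l
      · subst hil
        rw [hΓ.translate_dualMul_dualPow_self _ _ hs, hΓ.translate_dualPow_self,
          hΓ.translate_dualPow_self, dualMul_smul_left, smul_smul, Nat.add_sub_cancel]
        have h1 : ((q ^ C.c i i) ^ s * ∑ t ∈ Finset.range r, (q ^ C.c i i) ^ t)
            • D.dualMul (D.dualPow (Γ i) (r - 1)) (D.dualPow (Γ i) s)
            = ((q ^ C.c i i) ^ s * ∑ t ∈ Finset.range r, (q ^ C.c i i) ^ t)
              • D.dualPow (Γ i) N := by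
          rcases Nat.eq_zero_or_pos r with rfl | hr
          · simp
          · rw [ih (r - 1) s hs (by omega)]
        have h2 : (∑ t ∈ Finset.range s, (q ^ C.c i i) ^ t)
            • D.dualMul (D.dualPow (Γ i) r) (D.dualPow (Γ i) (s - 1))
            = (∑ t ∈ Finset.range s, (q ^ C.c i i) ^ t) • D.dualPow (Γ i) N := by
          rcases Nat.eq_zero_or_pos s with rfl | hs'
          · simp
          · rw [ih r (s - 1) (by omega) (by omega)]
        -- With `x = q^{c_ii}`, the geometric sums of lengths `s` and `r` combine, the latter
        -- shifted by `x^s`, into the one of length `r + s`.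
        rw [h1, h2, ← add_smul, ← h, add_comm r s, Finset.sum_range_add, add_comm, Finset.mul_sum]
        simp only [pow_add]
      · rw [hΓ.translate_dualMul_dualPow_ne _ hil hs, hΓ.translate_dualPow_ne hil,
          hΓ.translate_dualPow_ne hil, dualMul_zero_left, smul_zero]

/-- A linear combination of the products `((Γ i)^r · Γ j) · (Γ i)^s`, `r + s = N + 1`, vanishes when
its coefficients satisfy the relations that express the vanishing of its translates. -/
theorem sum_smul_eq_zero (hΓ : D.IsDualFamily Γ) {i j : Fin m} (hij : i ≠ j) {N : ℕ}
    (hN : N + 1 < n) (a : ℕ → k)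
    (ha : ∀ r s, r + s = N →
      a s * (q ^ C.c i i) ^ s * q ^ C.c i j * (∑ t ∈ Finset.range (r + 1), (q ^ C.c i i) ^ t)
        + a (s + 1) * (∑ t ∈ Finset.range (s + 1), (q ^ C.c i i) ^ t) = 0)
    (ha' : ∑ s ∈ Finset.range (N + 2), a s * (q ^ C.c j i) ^ s = 0) :
    ∑ p ∈ Finset.HasAntidiagonal.antidiagonal (N + 1),
      a p.2 • D.dualMul (D.dualMul (D.dualPow (Γ i) p.1) (Γ j)) (D.dualPow (Γ i) p.2) = 0 := by
  have hlt : ∀ p ∈ Finset.HasAntidiagonal.antidiagonal (N + 1), p.2 < n := fun p hp => by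
    have := Finset.HasAntidiagonal.mem_antidiagonal.mp hp; omega
  refine dual_ext (fun u hu => ?_) fun l => ?_
  · rw [LinearMap.sum_apply, LinearMap.zero_apply]
    refine Finset.sum_eq_zero fun p _ => ?_
    rw [LinearMap.smul_apply, dualMul_apply_hMonomials _ _ hu, dualMul_apply_hMonomials _ _ hu,
      hΓ.apply_hMonomials j u hu, mul_zero, zero_mul, smul_zero]
  rw [map_sum, map_zero]
  by_cases hil : i = l
  · subst hil
    -- `e i` removes one factor `Γ i`, either to the left or to the right of `Γ j`.
    have h1 : ∀ p ∈ Finset.HasAntidiagonal.antidiagonal (N + 1), D.translate (D.eA i)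
        (a p.2 • D.dualMul (D.dualMul (D.dualPow (Γ i) p.1) (Γ j)) (D.dualPow (Γ i) p.2))
        = (a p.2 * (q ^ C.c i i) ^ p.2 * q ^ C.c i j
              * ∑ t ∈ Finset.range p.1, (q ^ C.c i i) ^ t)
            • D.dualMul (D.dualMul (D.dualPow (Γ i) (p.1 - 1)) (Γ j)) (D.dualPow (Γ i) p.2)
          + (a p.2 * ∑ t ∈ Finset.range p.2, (q ^ C.c i i) ^ t)
            • D.dualMul (D.dualMul (D.dualPow (Γ i) p.1) (Γ j)) (D.dualPow (Γ i) (p.2 - 1)) := by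
      intro p hp
      rw [map_smul, hΓ.translate_dualMul_dualPow_self _ _ (hlt p hp),
        hΓ.translate_dualMul_ne _ hij.symm, hΓ.translate_dualPow_self, dualMul_smul_left,
        dualMul_smul_left, dualMul_smul_left]
      module
    -- The terms from `(r+1, s)` and `(r, s+1)` meet at `r + s = N`; the boundary terms have empty
    -- geometric sums.
    rw [Finset.sum_congr rfl h1, Finset.sum_add_distrib, Finset.Nat.sum_antidiagonal_succ,
      Finset.Nat.sum_antidiagonal_succ', Finset.sum_range_zero, mul_zero, mul_zero, zero_smul,
      zero_smul, zero_add, zero_add, ← Finset.sum_add_distrib]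
    refine Finset.sum_eq_zero fun p hp => ?_
    dsimp only
    rw [Nat.add_sub_cancel, Nat.add_sub_cancel, ← add_smul,
      ha p.1 p.2 (Finset.HasAntidiagonal.mem_antidiagonal.mp hp), zero_smul]
  · by_cases hjl : j = l
    · subst hjl
      -- Once `Γ j` is removed, the two powers of `Γ i` merge by `dualPow_add`.
      have h1 : ∀ p ∈ Finset.HasAntidiagonal.antidiagonal (N + 1), D.translate (D.eA j)
          (a p.2 • D.dualMul (D.dualMul (D.dualPow (Γ i) p.1) (Γ j)) (D.dualPow (Γ i) p.2))
          = (a p.2 * (q ^ C.c j i) ^ p.2) • D.dualPow (Γ i) (N + 1) := by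
        intro p hp
        rw [map_smul, hΓ.translate_dualMul_dualPow_ne _ hij (hlt p hp),
          hΓ.translate_dualMul_self, hΓ.translate_dualPow_ne hij, dualMul_zero_left, smul_zero,
          zero_add, hΓ.dualPow_add i _ _ (hlt p hp), Finset.HasAntidiagonal.mem_antidiagonal.mp hp, smul_smul]
      rw [Finset.sum_congr rfl h1, ← Finset.sum_smul]
      rw [← Finset.Nat.sum_antidiagonal_swap, Finset.Nat.sum_antidiagonal_eq_sum_range_succ_mk]
      dsimp only [Prod.swap]
      rw [ha', zero_smul]
    · refine Finset.sum_eq_zero fun p hp => ?_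
      rw [map_smul, hΓ.translate_dualMul_dualPow_ne _ hil (hlt p hp),
        hΓ.translate_dualMul_ne _ hjl, hΓ.translate_dualPow_ne hil, dualMul_zero_left, smul_zero,
        dualMul_zero_left, smul_zero, smul_zero]

end IsDualFamily
end QuantumBorel

namespace QuantumBorel

variable {k : Type*} [Field k] {n : ℕ} {q : k} {m : ℕ} {C : CartanDatum m}
  {H : Type*} [Ring H] [HopfAlgebra k H] {D : QuantumBorel k n q C H}

/-! ### The grading -/

/-- Commutation rules for `unitMonomial` then follow by comparing eigenvalues on weight vectors,
without permuting its ordered product. -/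
theorem eq_of_mul_idem {x y : H}
    (hxy : ∀ a : Fin m → Fin (n ^ 2), x * D.idem (fun i => a i) = y * D.idem (fun i => a i)) :
    x = y := by
  rw [← mul_one x, ← mul_one y, ← idem_sum (D := D), Finset.mul_sum, Finset.mul_sum]
  exact Finset.sum_congr rfl fun a _ => hxy a

theorem e_mul_unitMonomial (i : Fin m) (b : Fin m → ℤ) :
    D.e i * ((unitMonomial D.g b : Hˣ) : H)
      = q ^ (-b i) • (((unitMonomial D.g b : Hˣ) : H) * D.e i) := by
  refine eq_of_mul_idem (D := D) fun a => ?_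
  have ha := idem_weight (D := D) a
  rw [mul_assoc, unitMonomial_act b ha, smul_mul_assoc, mul_assoc,
    unitMonomial_act b (e_weight i ha), mul_smul_comm, smul_smul, ← zpow_add₀ (q_ne D)]
  congr 2
  simp [mul_add, Finset.sum_add_distrib, Pi.single_apply]

theorem h_act {w : Fin m → ℤ} {x : H} (hx : D.HasWeight w x) (i : Fin m) :
    D.h i * x = (q ^ w i) ^ n • x := by
  have hp : ∀ j : ℕ, (D.g i : H) ^ j * x = (q ^ w i) ^ j • x := by
    intro j
    induction j with
    | zero => simp
    | succ j ih => rw [pow_succ, mul_assoc, hx i, mul_smul_comm, ih, smul_smul, pow_succ']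
  exact hp n

theorem h_mul_unitMonomial (i : Fin m) (b : Fin m → ℤ) :
    D.h i * ((unitMonomial D.g b : Hˣ) : H)
      = ((unitMonomial D.g (b + Pi.single i (n : ℤ)) : Hˣ) : H) := by
  refine eq_of_mul_idem (D := D) fun a => ?_
  have ha := idem_weight (D := D) a
  rw [mul_assoc, unitMonomial_act _ ha, unitMonomial_act _ ha, mul_smul_comm, h_act ha, smul_smul,
    ← zpow_natCast, ← zpow_mul, ← zpow_add₀ (q_ne D)]
  congr 2
  simp [add_mul, Finset.sum_add_distrib, Pi.single_apply, mul_comm (n : ℤ)]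

theorem one_mem_degreeSpan : (1 : H) ∈ degreeSpan k D.g D.e 0 := by
  refine Submodule.subset_span ⟨0, [], rfl, ?_⟩
  simp [unitMonomial]

theorem h_mul_mem_degreeSpan (i : Fin m) {N : ℕ} {x : H} (hx : x ∈ degreeSpan k D.g D.e N) :
    D.h i * x ∈ degreeSpan k D.g D.e N := by
  induction hx using Submodule.span_induction with
  | mem x hx =>
    obtain ⟨b, w, hw, rfl⟩ := hx
    rw [← mul_assoc, h_mul_unitMonomial]
    exact Submodule.subset_span ⟨_, w, hw, rfl⟩
  | zero => rw [mul_zero]; exact zero_mem _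
  | add x y _ _ hx hy => rw [mul_add]; exact add_mem hx hy
  | smul c x _ hx => rw [mul_smul_comm]; exact Submodule.smul_mem _ _ hx

theorem e_mul_mem_degreeSpan (i : Fin m) {N : ℕ} {x : H} (hx : x ∈ degreeSpan k D.g D.e N) :
    D.e i * x ∈ degreeSpan k D.g D.e (N + 1) := by
  induction hx using Submodule.span_induction with
  | mem x hx =>
    obtain ⟨b, w, hw, rfl⟩ := hx
    rw [← mul_assoc, e_mul_unitMonomial, smul_mul_assoc, mul_assoc]
    exact Submodule.smul_mem _ _ (Submodule.subset_span ⟨b, i :: w, by simp [hw], by simp⟩)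
  | zero => rw [mul_zero]; exact zero_mem _
  | add x y _ _ hx hy => rw [mul_add]; exact add_mem hx hy
  | smul c x _ hx => rw [mul_smul_comm]; exact Submodule.smul_mem _ _ hx

theorem hIdem_mul_mem_degreeSpan (a : Fin m → ℕ) {N : ℕ} {x : H}
    (hx : x ∈ degreeSpan k D.g D.e N) : D.hIdem a * x ∈ degreeSpan k D.g D.e N := by
  have hpow : ∀ (i : Fin m) (j : ℕ), ∀ y ∈ degreeSpan k D.g D.e N,
      D.h i ^ j * y ∈ degreeSpan k D.g D.e N := by
    intro i j y hy
    induction j with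
    | zero => simpa using hy
    | succ j ih => rw [pow_succ', mul_assoc]; exact h_mul_mem_degreeSpan i ih
  have hcyc : ∀ (i : Fin m), ∀ y ∈ degreeSpan k D.g D.e N,
      cyclicIdem n (q ^ n) (D.h i) (a i) * y ∈ degreeSpan k D.g D.e N := by
    intro i y hy
    rw [cyclicIdem, smul_mul_assoc, Finset.sum_mul]
    refine Submodule.smul_mem _ _ (sum_mem fun j _ => ?_)
    rw [smul_mul_assoc]
    exact Submodule.smul_mem _ _ (hpow i j y hy)
  have hlist : ∀ l : List H, (∀ z ∈ l, ∀ y ∈ degreeSpan k D.g D.e N,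
      z * y ∈ degreeSpan k D.g D.e N) → l.prod * x ∈ degreeSpan k D.g D.e N := by
    intro l hl
    induction l with
    | nil => simpa using hx
    | cons z l ih =>
      rw [List.prod_cons, mul_assoc]
      exact hl z List.mem_cons_self _ (ih fun z' hz' => hl z' (List.mem_cons_of_mem _ hz'))
  refine hlist _ fun z hz => ?_
  obtain ⟨i, rfl⟩ := List.mem_ofFn.mp hz
  exact hcyc i

theorem hMonomials_mem_degreeSpan {u : D.A} (hu : u ∈ D.hMonomials) :
    (u : H) ∈ degreeSpan k D.g D.e 0 := by
  induction hu using hMonomials_induction with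
  | one => exact one_mem_degreeSpan
  | mul_h i y hy ih => exact h_mul_mem_degreeSpan i ih

theorem monomials_mem_degreeSpan {x : D.A} (hx : x ∈ D.monomials) :
    ∃ N, (x : H) ∈ degreeSpan k D.g D.e N := by
  induction hx using monomials_induction with
  | one => exact ⟨0, one_mem_degreeSpan⟩
  | mul_h i y hy ih =>
    obtain ⟨N, hN⟩ := ih
    exact ⟨N, h_mul_mem_degreeSpan i hN⟩
  | mul_e i y hy ih =>
    obtain ⟨N, hN⟩ := ih
    exact ⟨N + 1, e_mul_mem_degreeSpan i hN⟩

/-- With respect to a homogeneous basis, the coordinates of a homogeneous element at basis elements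
of a different degree vanish. -/
theorem coord_eq_zero_of_mem_degreeSpan {ι : Type*} (x : Module.Basis ι k D.A)
    (hx : ∀ t, ∃ N, (x t : H) ∈ degreeSpan k D.g D.e N) {M N : ℕ} (hMN : M ≠ N) {t : ι}
    (ht : (x t : H) ∈ degreeSpan k D.g D.e M) {z : D.A} (hz : (z : H) ∈ degreeSpan k D.g D.e N) :
    x.coord t z = 0 := by
  classical
  choose deg hdeg using hx
  have hsum : ∑ s ∈ (x.repr z).support, x.repr z s • x s = z := by
    conv_rhs => rw [← x.linearCombination_repr z, Finsupp.linearCombination_apply, Finsupp.sum]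
  rw [← Finset.sum_filter_add_sum_filter_not _ (fun s => deg s = N)] at hsum
  set z₁ := ∑ s ∈ (x.repr z).support with deg s = N, x.repr z s • x s with hz₁
  set z₂ := ∑ s ∈ (x.repr z).support with ¬ deg s = N, x.repr z s • x s with hz₂
  have h1 : (z₁ : H) ∈ degreeSpan k D.g D.e N := by
    rw [hz₁, AddSubmonoidClass.coe_finsetSum]
    refine sum_mem fun s hs => ?_
    have := hdeg s
    rw [(Finset.mem_filter.mp hs).2] at this
    exact Submodule.smul_mem _ _ this
  have h2 : (z₂ : H) ∈ ⨆ (M) (_ : M ≠ N), degreeSpan k D.g D.e M := by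
    rw [hz₂, AddSubmonoidClass.coe_finsetSum]
    refine sum_mem fun s hs => Submodule.smul_mem _ _ ?_
    exact le_iSup₂_of_le (f := fun M (_ : M ≠ N) => degreeSpan k D.g D.e M) (deg s)
      (Finset.mem_filter.mp hs).2 le_rfl (hdeg s)
  have h3 : (z₂ : H) ∈ degreeSpan k D.g D.e N := by
    have : (z₂ : H) = z - z₁ := by rw [← hsum]; simp
    rw [this]
    exact sub_mem hz h1
  -- The part of `z` on basis elements of other degrees also has degree `N`, so independence of the
  -- degrees kills it.
  have h4 : z₂ = 0 := Subtype.ext (Submodule.disjoint_def.mp (D.graded N) _ h3 h2)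
  rw [h4, add_zero] at hsum
  have hmem : z ∈ Submodule.span k (x '' {s | deg s = N}) := by
    rw [← hsum]
    exact sum_mem fun s hs => Submodule.smul_mem _ _
      (Submodule.subset_span ⟨s, (Finset.mem_filter.mp hs).2, rfl⟩)
  -- A nonzero coordinate would put `x t` in degree `N` as well as in degree `M`, forcing `x t = 0`.
  by_contra hne
  have h5 : deg t = N := x.repr_support_subset_of_mem_span _ hmem (Finsupp.mem_support_iff.mpr hne)
  have h6 := hdeg t
  rw [h5] at h6
  have h7 : (x t : H) ∈ ⨆ (M) (_ : M ≠ N), degreeSpan k D.g D.e M :=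
    le_iSup₂_of_le (f := fun M (_ : M ≠ N) => degreeSpan k D.g D.e M) M hMN le_rfl ht
  exact x.ne_zero t (Subtype.ext (Submodule.disjoint_def.mp (D.graded N) _ h6 h7))

/-! ### The dual basis elements `Γ i` -/

/-- In effect `1_a e_j = e_j 1_{a - ε_j}`; a scalar on each side avoids negative exponents. -/
theorem hIdemA_mul_eA_mul_hA (a : Fin m → Fin n) (j l : Fin m) :
    (q ^ n) ^ (if l = j then 1 else 0 : ℕ) • (D.hIdemA a * D.eA j * D.hA l)
      = (q ^ n) ^ (a l : ℕ) • (D.hIdemA a * D.eA j) := by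
  rw [← smul_mul_assoc ((q ^ n) ^ (a l : ℕ)), ← hIdemA_mul_hA, mul_assoc, mul_assoc, hA_mul_eA,
    mul_smul_comm]

theorem hIdemA_mul_eA_mul_hMonomials (a : Fin m → Fin n) (j : Fin m) {u : D.A}
    (hu : u ∈ D.hMonomials) :
    ∃ c : k, D.hIdemA a * D.eA j * u = c • (D.hIdemA a * D.eA j) := by
  have hq : q ^ n ≠ 0 := pow_ne_zero _ (q_ne D)
  induction hu using hMonomials_induction with
  | one => exact ⟨1, by rw [mul_one, one_smul]⟩
  | mul_h l y hy ih =>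
    obtain ⟨c, hc⟩ := ih
    refine ⟨((q ^ n) ^ (if l = j then 1 else 0 : ℕ))⁻¹ * (q ^ n) ^ (a l : ℕ) * c, ?_⟩
    have h1 := hIdemA_mul_eA_mul_hA (D := D) a j l
    rw [← eq_inv_smul_iff₀ (pow_ne_zero _ hq)] at h1
    rw [← mul_assoc, h1, smul_mul_assoc, smul_mul_assoc, hc, smul_smul, smul_smul, mul_assoc]

variable (D) in
/-- The unit vector `ε_i` as an element of `(ℤ/n)^m`. -/
def unitVec (i : Fin m) : Fin m → Fin n := fun s =>
  ⟨(Pi.single i 1 : Fin m → ℕ) s, single_lt i (by have := D.two_le; omega) s⟩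

theorem unitVec_apply (i l : Fin m) : (D.unitVec i l : ℕ) = if l = i then 1 else 0 :=
  Pi.single_apply i 1 l

/-- Since `1_{ε_i} e_i = e_i 1_0`, the right action of the `h l` is trivial. This is why `Γ i` is
taken dual to `1_{ε_i} e_i`. -/
theorem hIdemA_unitVec_mul_eA_mul_hA (i l : Fin m) :
    D.hIdemA (D.unitVec i) * D.eA i * D.hA l = D.hIdemA (D.unitVec i) * D.eA i := by
  have h1 := hIdemA_mul_eA_mul_hA (D := D) (D.unitVec i) i l
  rw [unitVec_apply] at h1
  exact smul_right_injective _ (pow_ne_zero _ (pow_ne_zero _ (q_ne D))) h1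

theorem hIdemA_unitVec_mul_eA_mul_hMonomials (i : Fin m) {u : D.A} (hu : u ∈ D.hMonomials) :
    D.hIdemA (D.unitVec i) * D.eA i * u = D.hIdemA (D.unitVec i) * D.eA i := by
  induction hu using hMonomials_induction with
  | one => rw [mul_one]
  | mul_h l y hy ih => rw [← mul_assoc, hIdemA_unitVec_mul_eA_mul_hA, ih]

/-- The left eigenvalues of the `h l` recover `a`; the right eigenvalue of `h i` then detects `j`.
-/
theorem hIdemA_mul_eA_inj {a : Fin m → Fin n} {i j : Fin m}
    (h0 : D.hIdemA (D.unitVec i) * D.eA i ≠ 0)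
    (h : D.hIdemA a * D.eA j = D.hIdemA (D.unitVec i) * D.eA i) : a = D.unitVec i ∧ j = i := by
  have ha : a = D.unitVec i := by
    funext l
    have h1 := congrArg (D.hA l * ·) h
    simp only [← mul_assoc, hA_mul_hIdemA, smul_mul_assoc] at h1
    rw [h] at h1
    exact Fin.ext ((prim_n D).pow_inj (Fin.is_lt _) (Fin.is_lt _) (smul_left_injective _ h0 h1))
  refine ⟨ha, ?_⟩
  by_contra hji
  have h1 := hIdemA_mul_eA_mul_hA (D := D) a j i
  rw [h, hIdemA_unitVec_mul_eA_mul_hA, if_neg (Ne.symm hji), ha, unitVec_apply, if_pos rfl] at h1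
  have h2 := (prim_n D).pow_inj (by have := D.two_le; omega) (by have := D.two_le; omega)
    (smul_left_injective _ h0 h1)
  omega

theorem isDualFamily_of_basis {ι : Type*} (x : Module.Basis ι k D.A)
    (hx : ∀ t, ∃ N, (x t : H) ∈ degreeSpan k D.g D.e N)
    (hxe : ∀ (a : Fin m → Fin n) (i : Fin m), ∃ t, (x t : H) = D.hIdem (fun s => a s) * D.e i)
    {Γ : Fin m → Module.Dual k D.A}
    (hΓ : ∀ i, ∃ t, (x t : H) = D.hIdem (Pi.single i 1) * D.e i ∧ Γ i = x.coord t) :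
    D.IsDualFamily Γ := by
  classical
  have hdeg : ∀ i N, N ≠ 1 → ∀ z : D.A, (z : H) ∈ degreeSpan k D.g D.e N → Γ i z = 0 := by
    intro i N hN z hz
    obtain ⟨t, ht, hΓt⟩ := hΓ i
    rw [hΓt]
    refine coord_eq_zero_of_mem_degreeSpan x hx hN.symm ?_ hz
    rw [ht]
    have h1 := e_mul_mem_degreeSpan i (one_mem_degreeSpan (D := D))
    rw [mul_one] at h1
    exact hIdem_mul_mem_degreeSpan _ h1
  have hbasis : ∀ i j a, Γ i (D.hIdemA a * D.eA j) = if a = D.unitVec i ∧ i = j then 1 else 0 := by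
    intro i j a
    obtain ⟨t, ht, hΓt⟩ := hΓ i
    obtain ⟨s, hs⟩ := hxe a j
    have ht' : x t = D.hIdemA (D.unitVec i) * D.eA i := Subtype.ext ht
    have hs' : x s = D.hIdemA a * D.eA j := Subtype.ext hs
    rw [hΓt, ← hs', x.coord_apply, x.repr_self, Finsupp.single_apply]
    refine if_congr ⟨?_, ?_⟩ rfl rfl
    · rintro rfl
      obtain ⟨h1, h2⟩ := hIdemA_mul_eA_inj (ht' ▸ x.ne_zero s) (hs'.symm.trans ht')
      exact ⟨h1, h2.symm⟩
    · rintro ⟨rfl, rfl⟩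
      exact x.injective (hs'.trans ht'.symm)
  -- Insert `1 = ∑ 1_a` on the left: each `1_a e_j` absorbs `u` up to a scalar, and only `1_{ε_i}
  -- e_i`, with scalar `1`, is seen by `Γ i`.
  have hmon : ∀ i j, ∀ u ∈ D.hMonomials, Γ i (D.eA j * u) = if i = j then 1 else 0 := by
    intro i j u hu
    rw [← one_mul (D.eA j * u), ← hIdemA_sum, Finset.sum_mul, map_sum,
      Finset.sum_eq_single (D.unitVec i)]
    · rw [← mul_assoc]
      by_cases hij : i = j
      · subst hij
        rw [hIdemA_unitVec_mul_eA_mul_hMonomials i hu, hbasis, if_pos ⟨rfl, rfl⟩, if_pos rfl]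
      · obtain ⟨c, hc⟩ := hIdemA_mul_eA_mul_hMonomials (D.unitVec i) j hu
        rw [hc, map_smul, hbasis, if_neg (fun h => hij h.2), if_neg hij, smul_zero]
    · intro a _ ha
      obtain ⟨c, hc⟩ := hIdemA_mul_eA_mul_hMonomials a j hu
      rw [← mul_assoc, hc, map_smul, hbasis, if_neg (fun h => ha h.1), smul_zero]
    · simp
  have htrans : ∀ i j, D.translate (D.eA j) (Γ i) = (if i = j then (1 : k) else 0) • D.dualOne := by
    intro i j
    refine dual_ext_monomials fun y hy => ?_
    rcases monomials_cases hy with hu | ⟨c, l, z, hz, rfl⟩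
    · rw [translate_apply, hmon i j y hu, LinearMap.smul_apply, dualOne_apply_hMonomials hu,
        smul_eq_mul, mul_one]
    -- Here `e j * e l * z` has degree at least `2`, so `Γ i` kills it, just as `ε` kills `e l * z`.
    · obtain ⟨N, hN⟩ := monomials_mem_degreeSpan hz
      have h1 := LinearMap.congr_fun (translate_eA_dualOne (D := D) l) z
      rw [translate_apply, LinearMap.zero_apply] at h1
      rw [LinearMap.smul_apply, map_smul, map_smul, h1, translate_apply,
        hdeg i (N + 2) (by omega) _ (e_mul_mem_degreeSpan j (e_mul_mem_degreeSpan l hN)),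
        smul_zero, smul_zero]
  refine ⟨fun i u hu => hdeg i 0 (by omega) u (hMonomials_mem_degreeSpan hu), fun i => ?_,
    fun i j hij => ?_⟩
  · rw [htrans, if_pos rfl, one_smul]
  · rw [htrans, if_neg hij, zero_smul]

end QuantumBorel

/-! ### The quantum Serre relations in the dual -/

open QuantumBorel in
theorem proposition3p4 {k : Type*} [Field k] [IsAlgClosed k] [CharZero k] {n : ℕ} (hn : 4 ≤ n)
    {q : k} {m : ℕ} (C : CartanDatum m) {H : Type*} [Ring H] [HopfAlgebra k H]
    [FiniteDimensional k H] (D : QuantumBorel k n q C H)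
    -- a basis of `A_q(𝔤)` of homogeneous elements that contains all the elements `1_a e_i`
    {ι : Type*} (x : Module.Basis ι k D.A)
    (hx : ∀ t, ∃ N, (x t : H) ∈ degreeSpan k D.g D.e N)
    (hxe : ∀ (a : Fin m → Fin n) (i : Fin m), ∃ t, (x t : H) = D.hIdem (fun s => a s) * D.e i)
    -- `Γ^i` is the element of the dual basis that corresponds to `1_{ε_i} e_i`
    (Γ : Fin m → Module.Dual k D.A)
    (hΓ : ∀ i, ∃ t, (x t : H) = D.hIdem (Pi.single i 1) * D.e i ∧ Γ i = x.coord t)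
    (i j : Fin m) (hij : i ≠ j) (hG : ¬ (n = 4 ∧ C.a i j = -3)) :
    ∑ p ∈ Finset.HasAntidiagonal.antidiagonal (1 - C.a i j).toNat,
      ((-1) ^ p.2 * qBinomial q (C.d i) (1 - C.a i j).toNat p.2) •
        D.dualMul (D.dualMul (D.dualPow (Γ i) p.1) (Γ j)) (D.dualPow (Γ i) p.2) = 0 := by
  have hfam := isDualFamily_of_basis x hx hxe hΓ
  have hq := q_ne D
  obtain ⟨N, hN⟩ : ∃ N : ℕ, C.a i j = -(N : ℤ) :=
    ⟨(-C.a i j).toNat, by have := C.nonpos i j hij; omega⟩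
  have hN3 : N ≤ 3 := by have := C.neg_three_le hij; omega
  have hNn : N + 1 < n := by omega
  have hb : ∀ t, 1 ≤ t → t ≤ N + 1 → qBracket q (C.d i) t ≠ 0 := by
    -- Divisibility would force `n² ≤ 2 · 3 · 4 = 24`, so `n = 4` and `8 ∣ d_i t`. The excluded case
    -- leaves `t ≤ 3`, and no product of two numbers in `{1, 2, 3}` is `8`.
    have key : ∀ t, 1 ≤ t → t ≤ N + 1 → ¬ n ^ 2 ∣ 2 * (C.d i * t) := by
      intro t h1 h2 hdvd
      have hd := C.d_mem i
      have hpos : 0 < 2 * (C.d i * t) := by have := C.d_pos i; positivity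
      have hle := Nat.le_of_dvd hpos hdvd
      have hd3 : C.d i ≤ 3 := by omega
      have ht4 : C.d i * t ≤ 3 * 4 := Nat.mul_le_mul hd3 (by omega)
      have hn4 : n = 4 := by nlinarith
      subst hn4
      have ht3 : t ≤ 3 := by omega
      rcases hd with hd | hd | hd <;> rw [hd] at hdvd <;> omega
    intro t h1 h2
    refine qBracket_ne_zero D.prim (pow_ne_zero _ (n_ne D)) ?_ (key t h1 h2)
    -- The denominator of the bracket is the case `t = 1`.
    simpa using key 1 le_rfl (by omega)
  have hcii : q ^ C.c i i = (q ^ C.d i) ^ 2 := by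
    rw [CartanDatum.c, C.diag, zpow_mul, zpow_natCast]
    exact zpow_ofNat _ 2
  have hcij : q ^ C.c i j = ((q ^ C.d i) ^ N)⁻¹ := by
    rw [CartanDatum.c, hN, zpow_mul, zpow_natCast, zpow_neg, zpow_natCast]
  rw [show (1 - C.a i j).toNat = N + 1 by omega]
  refine hfam.sum_smul_eq_zero hij hNn (fun s => (-1) ^ s * qBinomial q (C.d i) (N + 1) s)
    (fun r s hrs => ?_) ?_
  · rw [hcii, hcij]
    exact serre_coeff_succ hq hb hrs
  · rw [C.c_comm j i, hcij]
    exact alternating_sum_qBinomial hq hb
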